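/- Work in the Poincaré disk model of the hyperbolic plane (the h-plane): its points are the points inside the unit circle (the absolute), h-lines are the intersections of the open disk with circles and lines perpendicular to the absolute, and the h-distance of distinct points $P,Q$ is $PQ_h=\ln\frac{AQ\cdot BP}{QB\cdot PA}$, where $A,B$ are the points of the absolute (ideal points) at which the h-line through $P,Q$ ends, in the order $A,P,Q,B$. The h-angle measure is the Euclidean angle between the tangent half-lines. An h-triangle is a triple of points of the h-plane that do not lie on one h-line. Its incircle is the h-circle of positive radius tangent to each of its three sides, and its inradius is the h-radius of the incircle. An ideal triangle is bounded by the three h-lines that join pairwise three distinct points of the absolute; its incircle is the h-circle of positive radius tangent to these three h-lines, and its inradius is the h-radius of the incircle. 1. Every h-triangle has exactly one incircle, and its inradius is less than $\tfrac12\ln 3$. 2. Every ideal triangle $ABC$ has exactly one incircle, and its inradius equals $\tfrac12\ln 3$. Moreover, the bound in 1 is attained in the limit: if points $X,Y,Z$ of the h-plane tend (in the Euclidean plane) to $A,B,C$ respectively, then $XYZ$ is eventually an h-triangle and its inradius tends to $\tfrac12\ln 3$. 3. (Angle of parallelism.) Let $P$ be a point of the h-plane off an h-line $\ell$. There is exactly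 one foot point $Q\in\ell$ of the perpendicular from $P$ to $\ell$. The angle of parallelism $\varphi$ of $P$ to $\ell$, that is, the least angle such that some h-line $(PZ)_h$ with $|\measuredangle_h QPZ|=\varphi$ does not intersect $\ell$, exists, and $h=PQ_h$ satisfies $$h=\tfrac12\ln\frac{1+\cos\varphi}{1-\cos\varphi}.$$ -/

import Mathlib

open Filter Topology ComplexConjugate

noncomputable section

namespace PoincareDisk

/-- The absolute: the unit circle of the Euclidean plane `ℂ`. -/
def absolute : Set ℂ := Metric.sphere 0 1

/-- The h-plane: the points inside the absolute. -/
def hPlane : Set ℂ := Metric.ball 0 1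

/-- `Γ` is a cline (circle or line) perpendicular to the absolute: either a circle with centre `c`
and radius `r > 0` that meets the unit circle at right angles (by Pythagoras, `|c|² = 1 + r²`), or a
line through the centre of the absolute. -/
def IsPerpCline (Γ : Set ℂ) : Prop :=
  (∃ (c : ℂ) (r : ℝ), 0 < r ∧ ‖c‖ ^ 2 = 1 + r ^ 2 ∧ Γ = Metric.sphere c r) ∨
  (∃ u : ℂ, ‖u‖ = 1 ∧ Γ = Set.range (fun t : ℝ => (t : ℂ) * u))

/-- h-lines: intersections of the h-plane with clines perpendicular to the absolute. -/
def IsHLine (l : Set ℂ) : Prop := ∃ Γ, IsPerpCline Γ ∧ l = Γ ∩ hPlane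

/-- The h-line through two distinct points `P`, `Q` of the closed disk. If `P` and `Q` are on the
absolute, it is the h-line with ideal points `P` and `Q`. -/
def hLine (P Q : ℂ) : Set ℂ := {W | W ∈ hPlane ∧ ∃ Γ, IsPerpCline Γ ∧ P ∈ Γ ∧ Q ∈ Γ ∧ W ∈ Γ}

/-- The h-distance: `|ln (AQ·BP / (QB·PA))|`, where `A`, `B` are the ideal points of an h-line
through `P` and `Q`. Exchanging `A` and `B` inverts the cross-ratio, so the absolute value selects
the order `A, P, Q, B` on the h-line. The set below has exactly one element for `P`, `Q` in the
h-plane (see `crossRatioSet_eq`), which is `0` if `P = Q`. -/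
def crossRatioSet (P Q : ℂ) : Set ℝ :=
  {d | ∃ Γ A B, IsPerpCline Γ ∧ P ∈ Γ ∧ Q ∈ Γ ∧ A ∈ Γ ∩ absolute ∧ B ∈ Γ ∩ absolute ∧ A ≠ B ∧
    d = |Real.log ((dist A Q * dist B P) / (dist Q B * dist P A))|}

/-- The h-distance of two points of the h-plane: the unique element of `crossRatioSet P Q`. -/
def hDist (P Q : ℂ) : ℝ := sSup (crossRatioSet P Q)

set_option maxRecDepth 100000 in
set_option maxHeartbeats 1000000 in
theorem cross_ratio_key (a1 a2 b1 b2 p1 p2 q1 q2 : ℝ) (ha : a1^2+a2^2=1) (hb : b1^2+b2^2=1) :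
  ((a1-b1)^2+(a2-b2)^2)*(2*(((a1-q1)^2+(a2-q2)^2)*((b1-p1)^2+(b2-p2)^2) + ((a1-p1)^2+(a2-p2)^2)*((b1-q1)^2+(b2-q2)^2))
   - ((a1-b1)^2+(a2-b2)^2)*(2*((p1-q1)^2+(p2-q2)^2)+(1-(p1^2+p2^2))*(1-(q1^2+q2^2))))
   = 4*((-(a2-b2)*a1+(a1-b1)*a2)*(1+p1^2+p2^2)-2*(-(a2-b2)*p1+(a1-b1)*p2))*((-(a2-b2)*a1+(a1-b1)*a2)*(1+q1^2+q2^2)-2*(-(a2-b2)*q1+(a1-b1)*q2)) := by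
  have e1 : a2^2 = 1 - a1^2 := by linarith
  have e2 : b2^2 = 1 - b1^2 := by linarith
  have e3 : a2^3 = a2*(1 - a1^2) := by rw [← e1]; ring
  have e4 : b2^3 = b2*(1 - b1^2) := by rw [← e2]; ring
  have e5 : a2^4 = (1 - a1^2)^2 := by rw [← e1]; ring
  have e6 : b2^4 = (1 - b1^2)^2 := by rw [← e2]; ring
  rw [← sub_eq_zero]
  ring_nf
  simp only [e1,e2,e3,e4,e5,e6]
  ring

theorem IsPerpCline.exists_eq {Γ : Set ℂ} (h : IsPerpCline Γ) :
    ∃ a b1 b2 : ℝ, a ^ 2 < b1 ^ 2 + b2 ^ 2 ∧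
      ∀ z : ℂ, z ∈ Γ → a * (1 + z.re ^ 2 + z.im ^ 2) = 2 * (b1 * z.re + b2 * z.im) := by
  rcases h with ⟨c, r, hr, hc, rfl⟩ | ⟨u, hu, rfl⟩
  · have hc' := hc
    rw [Complex.sq_norm, Complex.normSq_apply] at hc'
    refine ⟨1, c.re, c.im, by nlinarith, fun z hz => ?_⟩
    rw [mem_sphere_iff_norm] at hz
    have h2 : ‖z - c‖ ^ 2 = r ^ 2 := by rw [hz]
    rw [Complex.sq_norm, Complex.normSq_apply] at h2
    simp only [Complex.sub_re, Complex.sub_im] at h2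
    nlinarith
  · have hu' : ‖u‖ ^ 2 = 1 := by rw [hu]; norm_num
    rw [Complex.sq_norm, Complex.normSq_apply] at hu'
    refine ⟨0, -u.im, u.re, by nlinarith, ?_⟩
    rintro z ⟨t, rfl⟩
    simp
    ring

theorem exists_perpCline {P Q : ℂ} (hP : P ∈ hPlane) :
    ∃ Γ, IsPerpCline Γ ∧ P ∈ Γ ∧ Q ∈ Γ := by
  by_cases hd : P.re * Q.im - P.im * Q.re = 0
  · by_cases h0 : P = 0
    · by_cases h1 : Q = 0
      · exact ⟨_, Or.inr ⟨1, by simp, rfl⟩, ⟨0, by simp [h0]⟩, ⟨0, by simp [h1]⟩⟩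
      · have hn : (‖Q‖ : ℂ) ≠ 0 := by simpa using h1
        exact ⟨_, Or.inr ⟨Q / ‖Q‖, by simp [h1], rfl⟩, ⟨0, by simp [h0]⟩,
          ⟨‖Q‖, by field_simp⟩⟩
    · have hn : (‖P‖ : ℂ) ≠ 0 := by simpa using h0
      have hs : P.re ^ 2 + P.im ^ 2 ≠ 0 := by
        intro hs
        exact h0 (Complex.ext (by simp; nlinarith [sq_nonneg P.re, sq_nonneg P.im])
          (by simp; nlinarith [sq_nonneg P.re, sq_nonneg P.im]))
      refine ⟨_, Or.inr ⟨P / ‖P‖, by simp [h0], rfl⟩, ⟨‖P‖, by field_simp⟩,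
          ⟨‖P‖ * ((P.re * Q.re + P.im * Q.im) / (P.re ^ 2 + P.im ^ 2)), ?_⟩⟩
      have : (((‖P‖ * ((P.re * Q.re + P.im * Q.im) / (P.re ^ 2 + P.im ^ 2)) : ℝ)) : ℂ) * (P / ‖P‖)
          = (((P.re * Q.re + P.im * Q.im) / (P.re ^ 2 + P.im ^ 2) : ℝ) : ℂ) * P := by
        push_cast
        field_simp
      simp only [this]
      apply Complex.ext
      · rw [Complex.re_ofReal_mul]
        field_simp
        linear_combination P.im * hd
      · rw [Complex.im_ofReal_mul]
        field_simp
        linear_combination (-P.re) * hd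
  · set D := P.re * Q.im - P.im * Q.re with hD
    set p := 1 + P.re ^ 2 + P.im ^ 2 with hp
    set q := 1 + Q.re ^ 2 + Q.im ^ 2 with hq
    set c : ℂ := ⟨(p * Q.im - q * P.im) / (2 * D), (q * P.re - p * Q.re) / (2 * D)⟩ with hc
    have hcP : 2 * (c.re * P.re + c.im * P.im) = p := by
      simp only [hc]; field_simp; rw [hD]; ring
    have hcQ : 2 * (c.re * Q.re + c.im * Q.im) = q := by
      simp only [hc]; field_simp; rw [hD]; ring
    have hP1 : P.re ^ 2 + P.im ^ 2 < 1 := by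
      have h1 : ‖P‖ < 1 := by simpa [hPlane] using hP
      have h2 : ‖P‖ ^ 2 < 1 := by nlinarith [norm_nonneg P]
      rw [Complex.sq_norm, Complex.normSq_apply] at h2
      nlinarith
    have hc1 : 1 < c.re ^ 2 + c.im ^ 2 := by
      by_contra hcon
      have h3 : (c.re * P.re + c.im * P.im) ^ 2 ≤
          (c.re ^ 2 + c.im ^ 2) * (P.re ^ 2 + P.im ^ 2) := by
        nlinarith [sq_nonneg (c.re * P.im - c.im * P.re)]
      have h4 : (1 - (P.re ^ 2 + P.im ^ 2)) ^ 2 > 0 := by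
        have : 1 - (P.re ^ 2 + P.im ^ 2) > 0 := by linarith
        positivity
      have h5 : (c.re * P.re + c.im * P.im) = p / 2 := by linarith
      rw [h5, hp] at h3
      nlinarith [sq_nonneg P.re, sq_nonneg P.im]
    have hr : 0 < Real.sqrt (c.re ^ 2 + c.im ^ 2 - 1) := Real.sqrt_pos.mpr (by linarith)
    have hr2 : Real.sqrt (c.re ^ 2 + c.im ^ 2 - 1) ^ 2 = c.re ^ 2 + c.im ^ 2 - 1 :=
      Real.sq_sqrt (by linarith)
    refine ⟨Metric.sphere c (Real.sqrt (c.re ^ 2 + c.im ^ 2 - 1)),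
      Or.inl ⟨c, _, hr, ?_, rfl⟩, ?_, ?_⟩
    · rw [hr2, Complex.sq_norm, Complex.normSq_apply]; ring
    · rw [mem_sphere_iff_norm, ← sq_eq_sq₀ (norm_nonneg _) hr.le, hr2, Complex.sq_norm,
        Complex.normSq_apply]
      simp only [Complex.sub_re, Complex.sub_im]
      linarith
    · rw [mem_sphere_iff_norm, ← sq_eq_sq₀ (norm_nonneg _) hr.le, hr2, Complex.sq_norm,
        Complex.normSq_apply]
      simp only [Complex.sub_re, Complex.sub_im]
      linarith

theorem IsPerpCline.exists_ideal {Γ : Set ℂ} (h : IsPerpCline Γ) :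
    ∃ A B, A ∈ Γ ∩ absolute ∧ B ∈ Γ ∩ absolute ∧ A ≠ B := by
  rcases h with ⟨c, r, hr, hc, rfl⟩ | ⟨u, hu, rfl⟩
  · have hn : c.re ^ 2 + c.im ^ 2 = 1 + r ^ 2 := by
      rw [← hc, Complex.sq_norm, Complex.normSq_apply]; ring
    have hn0 : 1 + r ^ 2 ≠ 0 := by positivity
    have aux : ∀ s : ℝ, s ^ 2 = r ^ 2 →
        (⟨(c.re - s * c.im) / (1 + r ^ 2), (c.im + s * c.re) / (1 + r ^ 2)⟩ : ℂ) ∈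
          Metric.sphere c r ∩ absolute := by
      intro s hs
      constructor
      · rw [mem_sphere_iff_norm, ← sq_eq_sq₀ (norm_nonneg _) hr.le, Complex.sq_norm,
          Complex.normSq_apply]
        simp only [Complex.sub_re, Complex.sub_im]
        rw [← hs] at hn hn0 ⊢
        field_simp
        rw [← hn]
        have h1 : s ^ 2 = c.re ^ 2 + c.im ^ 2 - 1 := by linarith
        linear_combination ((c.re ^ 2 + c.im ^ 2) - (c.re ^ 2 + c.im ^ 2) ^ 2) * h1
      · rw [absolute, mem_sphere_iff_norm, sub_zero, ← sq_eq_sq₀ (norm_nonneg _) zero_le_one,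
          Complex.sq_norm, Complex.normSq_apply]
        field_simp
        linear_combination (1 + r ^ 2) * hn + (c.re ^ 2 + c.im ^ 2) * hs
    refine ⟨_, _, aux r rfl, aux (-r) (by ring), fun h => ?_⟩
    have h1 := congrArg Complex.re h
    have h2 := congrArg Complex.im h
    simp only at h1 h2
    field_simp at h1 h2
    have h3 : c.im = 0 := by nlinarith
    have h4 : c.re = 0 := by nlinarith
    rw [h3, h4] at hn
    nlinarith
  · refine ⟨u, -u, ⟨⟨1, by simp⟩, by simp [absolute, hu]⟩,
      ⟨⟨-1, by simp⟩, by simp [absolute, hu]⟩, fun h => ?_⟩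
    have : u = 0 := self_eq_neg.mp h
    simp [this] at hu

set_option maxHeartbeats 1000000 in
theorem cosh_of_mem_crossRatioSet {P Q : ℂ} (hP : P ∈ hPlane) (hQ : Q ∈ hPlane) {d : ℝ}
    (hd : d ∈ crossRatioSet P Q) :
    0 ≤ d ∧ Real.cosh d = 1 + 2 * dist P Q ^ 2 / ((1 - ‖P‖ ^ 2) * (1 - ‖Q‖ ^ 2)) := by
  obtain ⟨Γ, A, B, hΓ, hPΓ, hQΓ, ⟨hAΓ, hA⟩, ⟨hBΓ, hB⟩, hAB, rfl⟩ := hd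
  refine ⟨abs_nonneg _, ?_⟩
  obtain ⟨a, b1, b2, hab, hmem⟩ := hΓ.exists_eq
  have eA := hmem A hAΓ
  have eB := hmem B hBΓ
  have eP := hmem P hPΓ
  have eQ := hmem Q hQΓ
  have nsq : ∀ z : ℂ, ‖z‖ ^ 2 = z.re ^ 2 + z.im ^ 2 := fun z => by
    rw [Complex.sq_norm, Complex.normSq_apply]; ring
  have dsq : ∀ z w : ℂ, dist z w ^ 2 = (z.re - w.re) ^ 2 + (z.im - w.im) ^ 2 := fun z w => by
    rw [dist_eq_norm, nsq]; simp
  have nA : A.re ^ 2 + A.im ^ 2 = 1 := by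
    rw [← nsq, show ‖A‖ = 1 by simpa [absolute] using hA]; norm_num
  have nB : B.re ^ 2 + B.im ^ 2 = 1 := by
    rw [← nsq, show ‖B‖ = 1 by simpa [absolute] using hB]; norm_num
  have hP1 : ‖P‖ < 1 := by simpa [hPlane] using hP
  have hQ1 : ‖Q‖ < 1 := by simpa [hPlane] using hQ
  have nP : 0 < 1 - ‖P‖ ^ 2 := by nlinarith [norm_nonneg P]
  have nQ : 0 < 1 - ‖Q‖ ^ 2 := by nlinarith [norm_nonneg Q]
  have hk : 0 < dist A B := dist_pos.mpr hAB
  have ne : ∀ X Y : ℂ, X ∈ absolute → ‖Y‖ < 1 → 0 < dist X Y := by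
    intro X Y hX hY
    rw [dist_pos]
    rintro rfl
    have : ‖X‖ = 1 := by simpa [absolute] using hX
    linarith
  have hAQ := ne A Q hA hQ1
  have hBP := ne B P hB hP1
  have hQB : 0 < dist Q B := by rw [dist_comm]; exact ne B Q hB hQ1
  have hPA : 0 < dist P A := by rw [dist_comm]; exact ne A P hA hP1
  have G : ∀ z : ℂ, z ∈ Γ → (-(A.im - B.im) * A.re + (A.re - B.re) * A.im) *
      (1 + z.re ^ 2 + z.im ^ 2) - 2 * (-(A.im - B.im) * z.re + (A.re - B.re) * z.im) = 0 := by
    intro z hz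
    have ez := hmem z hz
    have eA' : a = b1 * A.re + b2 * A.im := by
      rw [show 1 + A.re ^ 2 + A.im ^ 2 = 2 by linarith] at eA; linarith
    have eB' : a = b1 * B.re + b2 * B.im := by
      rw [show 1 + B.re ^ 2 + B.im ^ 2 = 2 by linarith] at eB; linarith
    have e0 : b1 * (A.re - B.re) + b2 * (A.im - B.im) = 0 := by linarith
    rw [eA'] at ez
    have hb : 0 < b1 ^ 2 + b2 ^ 2 := by nlinarith [sq_nonneg a]
    have f1 : b1 * ((-(A.im - B.im) * A.re + (A.re - B.re) * A.im) *
      (1 + z.re ^ 2 + z.im ^ 2) - 2 * (-(A.im - B.im) * z.re + (A.re - B.re) * z.im)) = 0 := by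
      linear_combination (A.im * (1 + z.re ^ 2 + z.im ^ 2) - 2 * z.im) * e0
        - (A.im - B.im) * ez
    have f2 : b2 * ((-(A.im - B.im) * A.re + (A.re - B.re) * A.im) *
      (1 + z.re ^ 2 + z.im ^ 2) - 2 * (-(A.im - B.im) * z.re + (A.re - B.re) * z.im)) = 0 := by
      linear_combination (-A.re * (1 + z.re ^ 2 + z.im ^ 2) + 2 * z.re) * e0
        + (A.re - B.re) * ez
    rcases mul_eq_zero.mp f1 with h1 | h1
    · rcases mul_eq_zero.mp f2 with h2 | h2
      · rw [h1, h2] at hb; norm_num at hb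
      · exact h2
    · exact h1
  have GP := G P hPΓ
  have GQ := G Q hQΓ
  have K : ∀ X Y : ℂ, X ∈ Γ → Y ∈ Γ → 2 * (dist A Y ^ 2 * dist B X ^ 2 +
      dist A X ^ 2 * dist B Y ^ 2) =
      dist A B ^ 2 * (2 * dist X Y ^ 2 + (1 - ‖X‖ ^ 2) * (1 - ‖Y‖ ^ 2)) := by
    intro X Y hX hY
    have := cross_ratio_key A.re A.im B.re B.im X.re X.im Y.re Y.im nA nB
    rw [G X hX, mul_zero, zero_mul] at this
    rw [← dsq, ← dsq, ← dsq, ← dsq, ← dsq, ← dsq, ← nsq, ← nsq] at this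
    rcases mul_eq_zero.mp this with h | h
    · exact absurd h (by positivity)
    · exact sub_eq_zero.mp h
  have KPQ := K P Q hPΓ hQΓ
  have KK : ∀ X : ℂ, X ∈ Γ → ‖X‖ < 1 → dist A X * dist B X = dist A B * (1 - ‖X‖ ^ 2) / 2 := by
    intro X hX hX1
    have h := K X X hX hX
    have : 0 < 1 - ‖X‖ ^ 2 := by nlinarith [norm_nonneg X]
    rw [← sq_eq_sq₀ (by positivity) (by positivity)]
    rw [dist_self] at h
    linear_combination h / 4
  have KP := KK P hPΓ hP1
  have KQ := KK Q hQΓ hQ1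
  rw [dist_comm Q B, dist_comm P A] at *
  rw [Real.cosh_abs, Real.cosh_log (by positivity)]
  have hden : dist A Q * dist B P * (dist B Q * dist A P) =
      dist A B ^ 2 * ((1 - ‖P‖ ^ 2) * (1 - ‖Q‖ ^ 2)) / 4 := by
    linear_combination (dist A Q * dist B Q) * KP + (dist A B * (1 - ‖P‖ ^ 2) / 2) * KQ
  have e1 : (dist A Q * dist B P / (dist B Q * dist A P) +
      (dist A Q * dist B P / (dist B Q * dist A P))⁻¹) / 2 =
      ((dist A Q ^ 2 * dist B P ^ 2 + dist A P ^ 2 * dist B Q ^ 2)) /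
        (2 * (dist A Q * dist B P * (dist B Q * dist A P))) := by
    field_simp
  rw [e1, hden, show dist A Q ^ 2 * dist B P ^ 2 + dist A P ^ 2 * dist B Q ^ 2 =
    dist A B ^ 2 * (2 * dist P Q ^ 2 + (1 - ‖P‖ ^ 2) * (1 - ‖Q‖ ^ 2)) / 2 by linarith]
  field_simp
  ring

/-- The h-distance is well defined: `crossRatioSet P Q` has exactly one element. -/
theorem crossRatioSet_eq {P Q : ℂ} (hP : P ∈ hPlane) (hQ : Q ∈ hPlane) :
    crossRatioSet P Q = {hDist P Q} := by
  obtain ⟨Γ, hΓ, hPΓ, hQΓ⟩ := exists_perpCline (Q := Q) hP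
  obtain ⟨A, B, hA, hB, hAB⟩ := hΓ.exists_ideal
  have hne : (crossRatioSet P Q).Nonempty := ⟨_, Γ, A, B, hΓ, hPΓ, hQΓ, hA, hB, hAB, rfl⟩
  have hsub : (crossRatioSet P Q).Subsingleton := by
    intro x hx y hy
    have h1 := cosh_of_mem_crossRatioSet hP hQ hx
    have h2 := cosh_of_mem_crossRatioSet hP hQ hy
    have h3 : Real.cosh x = Real.cosh y := h1.2.trans h2.2.symm
    rw [← Real.cosh_abs x, ← Real.cosh_abs y] at h3
    have := le_antisymm (Real.cosh_le_cosh.mp (by simpa using h3.le))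
      (Real.cosh_le_cosh.mp (by simpa using h3.ge))
    simpa [abs_of_nonneg h1.1, abs_of_nonneg h2.1] using this
  obtain ⟨d, hd⟩ := (Set.exists_eq_singleton_iff_nonempty_subsingleton.mpr ⟨hne, hsub⟩)
  rw [hDist, hd, csSup_singleton]

/-- The h-distance in closed form. -/
theorem cosh_hDist {P Q : ℂ} (hP : P ∈ hPlane) (hQ : Q ∈ hPlane) :
    0 ≤ hDist P Q ∧
      Real.cosh (hDist P Q) = 1 + 2 * dist P Q ^ 2 / ((1 - ‖P‖ ^ 2) * (1 - ‖Q‖ ^ 2)) :=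
  cosh_of_mem_crossRatioSet hP hQ (by rw [crossRatioSet_eq hP hQ]; rfl)

/-- The h-segment `[PQ]_h`: the arc of the h-line through `P` and `Q` between `P` and `Q`. -/
def hSegment (P Q : ℂ) : Set ℂ := {W | W ∈ hLine P Q ∧ hDist P W + hDist W Q = hDist P Q}

/-- The h-circle with centre `I` and h-radius `r`. -/
def hCircle (I : ℂ) (r : ℝ) : Set ℂ := {W | W ∈ hPlane ∧ hDist I W = r}

/-- Nondegenerate h-triangles: three points of the h-plane not on one h-line. -/
def IsHTriangle (X Y Z : ℂ) : Prop :=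
  X ∈ hPlane ∧ Y ∈ hPlane ∧ Z ∈ hPlane ∧ ¬ ∃ l, IsHLine l ∧ X ∈ l ∧ Y ∈ l ∧ Z ∈ l

/-- The h-circle with centre `I` and h-radius `r` is tangent to the h-segment `[PQ]_h`: it meets
the h-line through `P` and `Q` in exactly one point, and that point lies on the segment. -/
def IsTangentToSegment (I : ℂ) (r : ℝ) (P Q : ℂ) : Prop :=
  ∃ T ∈ hSegment P Q, hCircle I r ∩ hLine P Q = {T}

/-- The h-circle with centre `I` and h-radius `r` is tangent to the h-line `l`. -/
def IsTangentToLine (I : ℂ) (r : ℝ) (l : Set ℂ) : Prop := ∃ T, hCircle I r ∩ l = {T}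

/-- The h-circle with centre `I` and h-radius `r > 0` is the incircle of the h-triangle `XYZ`: it is
tangent to each of the sides `[XY]_h`, `[YZ]_h`, `[ZX]_h`. Its radius `r` is the inradius. -/
def IsHIncircle (X Y Z I : ℂ) (r : ℝ) : Prop :=
  I ∈ hPlane ∧ 0 < r ∧
    IsTangentToSegment I r X Y ∧ IsTangentToSegment I r Y Z ∧ IsTangentToSegment I r Z X

/-- The incircle of the ideal triangle with ideal vertices `A`, `B`, `C` on the absolute, that is,
the triangle bounded by the three h-lines with ideal points `A, B`, `B, C` and `C, A`. -/
def IsIdealIncircle (A B C I : ℂ) (r : ℝ) : Prop :=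
  I ∈ hPlane ∧ 0 < r ∧
    IsTangentToLine I r (hLine A B) ∧ IsTangentToLine I r (hLine B C) ∧
    IsTangentToLine I r (hLine C A)

/-- The unit vector spanning the Euclidean half-line from `Q` tangent to `[QP]_h` at `Q`, for
distinct points `P`, `Q` of the h-plane. -/
def tangentDir (Q P : ℂ) : ℂ :=
  limUnder (𝓝[hSegment Q P \ {Q}] Q) (fun W => (‖W - Q‖⁻¹ : ℝ) • (W - Q))

/-- The absolute value (in `[0, π]`) of the h-angle measure of the h-angle `PQR`: the Euclidean
angle between the half-lines tangent to `[QP]_h` and `[QR]_h` at `Q`. -/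
def hAngle (P Q R : ℂ) : ℝ := InnerProductGeometry.angle (tangentDir Q P) (tangentDir Q R)

/-- `Q` is the foot point on the h-line `l` of the perpendicular from the point `P` off `l`. -/
def IsHFoot (l : Set ℂ) (P Q : ℂ) : Prop :=
  Q ∈ l ∧ ∀ R ∈ l, R ≠ Q → hAngle P Q R = Real.pi / 2

/-- `φ` is the angle of parallelism of `P` to `l`, where `Q` is the foot point of `P` on `l`: the
least angle such that an h-line `(PZ)_h` with `|∡_h QPZ| = φ` does not intersect `l`. -/
def IsAngleOfParallelism (l : Set ℂ) (P Q : ℂ) (φ : ℝ) : Prop :=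
  IsLeast {α : ℝ | ∃ Z ∈ hPlane, Z ≠ P ∧ hAngle Q P Z = α ∧ Disjoint (hLine P Z) l} φ

end PoincareDisk

end

open Filter Topology PoincareDisk

open ComplexConjugate

namespace PoincareDisk

/-! The proof moves to the hyperboloid model. `lift` sends a point of the disk to a unit time-like
vector, and there `cosh` of the h-distance is the Minkowski product (`cosh_hDist_eq`). The h-lines
are the sections by planes orthogonal to a space-like normal (`isHLine_iff`), and segments are the
nonnegative combinations of their endpoints (`mem_hSegment_iff`). A circle of radius `r > 0` about
`I` is tangent to the line with normal `n`, `mink n n = -m²`, exactly when `sinh r * m = |⟨I, n⟩|`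
(`isTangentToLine_iff`).

Incircles: expand `I` in the vertices by Cramer's rule. Tangency to the three sides fixes the
coefficients up to sign: they are `±sinh r` times the `sinh` of the opposite sides. Mixed signs are
excluded because the contact points lie on the segments. So `I` lies on one explicit line through
the origin (`isHIncircle_iff`), which meets the upper sheet once; this gives existence and
uniqueness. Comparing norms gives the radius. In terms of the tangent lengths `x, y, z` (`gromov`),
`sinh_inradius_sq` says `1 / sinh² r = coth y coth z + coth z coth x + coth x coth y`. Each `coth`
exceeds 1, so `sinh² r < 1/3 = sinh² (½ ln 3)`.

When the vertices tend to distinct ideal points, the tangent lengths tend to infinity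
(`tendsto_gromov`), every `coth` tends to 1 and the bound is approached. For an ideal triangle the
same Cramer argument runs with the null vectors `hom A`, `hom B`, `hom C`, and `mink_idealVec` gives
`sinh² r = 1/3` exactly.

Angles: a linear map `dirMap Q` carries lifted points to tangent directions at `Q`, which identifies
the limit defining `tangentDir` and yields the hyperbolic law of cosines (`cos_hAngle`). The foot
point is then the normalised orthogonal projection. An h-line through `P` misses `l` when a certain
vector is not time-like (`disjoint_hLine`). With the law of cosines this becomes `cos φ ≤ tanh h`,
with equality at the line that shares an ideal point with `l`. Solving `cos φ = tanh h` for `h` is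
the formula. -/

/-! ### Minkowski linear algebra -/

/-- The Minkowski form on `ℝ × ℝ × ℝ`, of signature `(+, -, -)`. -/
def mink (u v : ℝ × ℝ × ℝ) : ℝ := u.1 * v.1 - u.2.1 * v.2.1 - u.2.2 * v.2.2

/-- The Minkowski cross product. -/
def cross (u v : ℝ × ℝ × ℝ) : ℝ × ℝ × ℝ :=
  (u.2.1 * v.2.2 - u.2.2 * v.2.1, u.1 * v.2.2 - u.2.2 * v.1, u.2.1 * v.1 - u.1 * v.2.1)

/-- The determinant of three vectors. -/
def det3 (u v w : ℝ × ℝ × ℝ) : ℝ := mink w (cross u v)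

/-- The point of the light cone or its interior over a point of the closed disk. -/
def hom (z : ℂ) : ℝ × ℝ × ℝ := (1 + (z.re ^ 2 + z.im ^ 2), 2 * z.re, 2 * z.im)

/-- The point of the hyperboloid over a point of the h-plane. -/
noncomputable def lift (z : ℂ) : ℝ × ℝ × ℝ := (1 - (z.re ^ 2 + z.im ^ 2))⁻¹ • hom z

/-- The inverse of `lift`. -/
noncomputable def drop (v : ℝ × ℝ × ℝ) : ℂ := ⟨v.2.1 / (1 + v.1), v.2.2 / (1 + v.1)⟩

theorem mink_comm (u v : ℝ × ℝ × ℝ) : mink u v = mink v u := by simp only [mink]; ring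

theorem mink_add_left (u v w : ℝ × ℝ × ℝ) : mink (u + v) w = mink u w + mink v w := by
  simp only [mink, Prod.fst_add, Prod.snd_add]; ring

theorem mink_add_right (u v w : ℝ × ℝ × ℝ) : mink u (v + w) = mink u v + mink u w := by
  simp only [mink, Prod.fst_add, Prod.snd_add]; ring

theorem mink_sub_left (u v w : ℝ × ℝ × ℝ) : mink (u - v) w = mink u w - mink v w := by
  simp only [mink, Prod.fst_sub, Prod.snd_sub]; ring

theorem mink_sub_right (u v w : ℝ × ℝ × ℝ) : mink u (v - w) = mink u v - mink u w := by
  simp only [mink, Prod.fst_sub, Prod.snd_sub]; ring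

theorem mink_smul_left (k : ℝ) (u v : ℝ × ℝ × ℝ) : mink (k • u) v = k * mink u v := by
  simp only [mink, Prod.smul_fst, Prod.smul_snd, smul_eq_mul]; ring

theorem mink_smul_right (k : ℝ) (u v : ℝ × ℝ × ℝ) : mink u (k • v) = k * mink u v := by
  simp only [mink, Prod.smul_fst, Prod.smul_snd, smul_eq_mul]; ring

theorem mink_cross_left (u v : ℝ × ℝ × ℝ) : mink u (cross u v) = 0 := by
  simp only [mink, cross]; ring

theorem mink_cross_right (u v : ℝ × ℝ × ℝ) : mink v (cross u v) = 0 := by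
  simp only [mink, cross]; ring

theorem mink_cross_cross (u v : ℝ × ℝ × ℝ) :
    mink (cross u v) (cross u v) = mink u u * mink v v - mink u v ^ 2 := by
  simp only [mink, cross]; ring

theorem det3_rotate (u v w : ℝ × ℝ × ℝ) : det3 v w u = det3 u v w := by
  simp only [det3, mink, cross]; ring

/-- Cramer's rule. -/
theorem det3_smul_eq (u v w i : ℝ × ℝ × ℝ) :
    det3 u v w • i = det3 v w i • u + det3 w u i • v + det3 u v i • w := by
  refine Prod.ext ?_ (Prod.ext ?_ ?_) <;>
  simp only [det3, mink, cross, Prod.smul_fst, Prod.smul_snd, smul_eq_mul, Prod.fst_add,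
    Prod.snd_add] <;> ring

/-- The Gram determinant. -/
theorem det3_sq (u v w : ℝ × ℝ × ℝ) :
    det3 u v w ^ 2 = mink u u * mink v v * mink w w + 2 * mink u v * mink v w * mink w u
      - mink u u * mink v w ^ 2 - mink v v * mink w u ^ 2 - mink w w * mink u v ^ 2 := by
  simp only [det3, mink, cross]; ring

/-- Vectors orthogonal to a nonzero vector are linearly dependent. -/
theorem det3_eq_zero {u v w n : ℝ × ℝ × ℝ} (hn : mink n n ≠ 0) (hu : mink u n = 0)
    (hv : mink v n = 0) (hw : mink w n = 0) : det3 u v w = 0 := by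
  have h := congrArg (fun x => mink x n) (det3_smul_eq u v w n)
  simp only [mink_add_left, mink_smul_left, hu, hv, hw] at h
  simpa [hn] using h

theorem fst_ne_zero {v : ℝ × ℝ × ℝ} (h : 0 < mink v v) : v.1 ≠ 0 := by
  intro h0
  simp only [mink, h0] at h
  nlinarith [sq_nonneg v.2.1, sq_nonneg v.2.2]

/-- Time-like vectors with positive product lie in the same half of the light cone. -/
theorem fst_pos {u v : ℝ × ℝ × ℝ} (hv : 0 < mink v v) (hu : 0 < mink u u) (hu1 : 0 < u.1)
    (huv : 0 < mink v u) : 0 < v.1 := by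
  by_contra hc
  have h1 : v.1 * u.1 ≤ 0 := mul_nonpos_of_nonpos_of_nonneg (not_lt.mp hc) hu1.le
  simp only [mink] at *
  -- If the time components had product `≤ 0`, the space parts would have to outweigh them in
  -- absolute value, against Cauchy–Schwarz for time-like vectors.
  have h2 : (v.1 * u.1) ^ 2 < (v.2.1 * u.2.1 + v.2.2 * u.2.2) ^ 2 := by nlinarith
  have h3 : (v.2.1 * u.2.1 + v.2.2 * u.2.2) ^ 2 ≤
      (v.2.1 ^ 2 + v.2.2 ^ 2) * (u.2.1 ^ 2 + u.2.2 ^ 2) := by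
    nlinarith [sq_nonneg (v.2.1 * u.2.2 - v.2.2 * u.2.1)]
  have h4 : (v.2.1 ^ 2 + v.2.2 ^ 2) * (u.2.1 ^ 2 + u.2.2 ^ 2) ≤ v.1 ^ 2 * u.1 ^ 2 := by
    gcongr <;> nlinarith
  nlinarith

/-! ### The hyperboloid over the disk -/

/-- This is the link to the closed form of the h-distance. On the absolute the first term vanishes,
so ideal points become null vectors with positive mutual products. -/
theorem mink_hom (P Q : ℂ) : mink (hom P) (hom Q) =
    (1 - (P.re ^ 2 + P.im ^ 2)) * (1 - (Q.re ^ 2 + Q.im ^ 2)) + 2 * dist P Q ^ 2 := by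
  rw [dist_eq_norm, Complex.sq_norm, Complex.normSq_apply]
  simp only [mink, hom, Complex.sub_re, Complex.sub_im]; ring

theorem norm_sq_eq (z : ℂ) : ‖z‖ ^ 2 = z.re ^ 2 + z.im ^ 2 := by
  rw [Complex.sq_norm, Complex.normSq_apply]; ring

theorem mem_hPlane_iff {z : ℂ} : z ∈ hPlane ↔ 0 < 1 - (z.re ^ 2 + z.im ^ 2) := by
  rw [← norm_sq_eq, hPlane, mem_ball_zero_iff, sub_pos, sq_lt_one_iff₀ (norm_nonneg _)]

theorem mem_absolute_iff {z : ℂ} : z ∈ absolute ↔ 1 - (z.re ^ 2 + z.im ^ 2) = 0 := by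
  rw [← norm_sq_eq, absolute, mem_sphere_zero_iff_norm, sub_eq_zero,
    eq_comm (b := ‖z‖ ^ 2), pow_eq_one_iff_of_nonneg (norm_nonneg _) two_ne_zero]

theorem mink_lift (P Q : ℂ) : mink (lift P) (lift Q) =
    (1 - (P.re ^ 2 + P.im ^ 2))⁻¹ * ((1 - (Q.re ^ 2 + Q.im ^ 2))⁻¹ * mink (hom P) (hom Q)) := by
  simp only [lift, mink_smul_left, mink_smul_right]; ring

theorem mink_lift_self {P : ℂ} (hP : P ∈ hPlane) : mink (lift P) (lift P) = 1 := by
  have := mem_hPlane_iff.mp hP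
  rw [mink_lift, mink_hom, dist_self]
  field_simp
  ring

theorem lift_fst_pos {P : ℂ} (hP : P ∈ hPlane) : 0 < (lift P).1 := by
  have := mem_hPlane_iff.mp hP
  simp only [lift, hom, Prod.smul_fst, smul_eq_mul]
  positivity

theorem drop_mem {v : ℝ × ℝ × ℝ} (hv : mink v v = 1) (h : 0 < v.1) : drop v ∈ hPlane := by
  simp only [mink] at hv
  rw [mem_hPlane_iff, drop]
  have : 1 - ((v.2.1 / (1 + v.1)) ^ 2 + (v.2.2 / (1 + v.1)) ^ 2) = 2 / (1 + v.1) := by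
    field_simp
    linear_combination hv
  rw [this]
  positivity

theorem lift_drop {v : ℝ × ℝ × ℝ} (hv : mink v v = 1) (h : 0 < v.1) : lift (drop v) = v := by
  simp only [mink] at hv
  have h2 : 1 - ((v.2.1 / (1 + v.1)) ^ 2 + (v.2.2 / (1 + v.1)) ^ 2) = 2 / (1 + v.1) := by
    field_simp
    linear_combination hv
  have h3 : (v.2.1 / (1 + v.1)) ^ 2 + (v.2.2 / (1 + v.1)) ^ 2 = 1 - 2 / (1 + v.1) := by
    linarith
  simp only [lift, hom, drop, h3]
  refine Prod.ext ?_ (Prod.ext ?_ ?_) <;> simp <;> field_simp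
  ring

theorem exists_lift_eq {v : ℝ × ℝ × ℝ} (hv : mink v v = 1) (h : 0 < v.1) :
    ∃ W ∈ hPlane, lift W = v := ⟨drop v, drop_mem hv h, lift_drop hv h⟩

/-- Every time-like line meets the hyperboloid. -/
theorem exists_lift_eq_smul {v : ℝ × ℝ × ℝ} (hv : 0 < mink v v) :
    ∃ W ∈ hPlane, ∃ k : ℝ, lift W = k • v := by
  have hs : 0 < √(mink v v) := Real.sqrt_pos.mpr hv
  have hs2 : √(mink v v) ^ 2 = mink v v := Real.sq_sqrt hv.le
  have key : ∀ k : ℝ, k ^ 2 * mink v v = 1 → 0 < k * v.1 →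
      ∃ W ∈ hPlane, ∃ k : ℝ, lift W = k • v := by
    intro k hk h
    obtain ⟨W, hW, hl⟩ := exists_lift_eq (v := k • v)
      (by rw [mink_smul_left, mink_smul_right]; linarith) (by simpa using h)
    exact ⟨W, hW, k, hl⟩
  -- The sign of the factor is chosen so as to land on the upper sheet.
  rcases lt_or_gt_of_ne (fst_ne_zero hv) with h | h
  · exact key (-(√(mink v v))⁻¹) (by rw [neg_sq, inv_pow, hs2]; field_simp)
      (mul_pos_of_neg_of_neg (by simpa using hs) h)
  · exact key (√(mink v v))⁻¹ (by rw [inv_pow, hs2]; field_simp) (by positivity)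

/-- The dictionary entry on which everything rests: metric statements become statements about a
bilinear form. -/
theorem cosh_hDist_eq {P Q : ℂ} (hP : P ∈ hPlane) (hQ : Q ∈ hPlane) :
    Real.cosh (hDist P Q) = mink (lift P) (lift Q) := by
  have h1 := mem_hPlane_iff.mp hP
  have h2 := mem_hPlane_iff.mp hQ
  rw [(cosh_hDist hP hQ).2, mink_lift, mink_hom, norm_sq_eq, norm_sq_eq]
  field_simp

theorem hDist_nonneg {P Q : ℂ} (hP : P ∈ hPlane) (hQ : Q ∈ hPlane) : 0 ≤ hDist P Q :=
  (cosh_hDist hP hQ).1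

theorem one_le_mink {P Q : ℂ} (hP : P ∈ hPlane) (hQ : Q ∈ hPlane) :
    1 ≤ mink (lift P) (lift Q) := by
  rw [← cosh_hDist_eq hP hQ]; exact Real.one_le_cosh _

theorem eq_of_mink_eq_one {P Q : ℂ} (hP : P ∈ hPlane) (hQ : Q ∈ hPlane)
    (h : mink (lift P) (lift Q) = 1) : P = Q := by
  have h1 := mem_hPlane_iff.mp hP
  have h2 := mem_hPlane_iff.mp hQ
  rw [mink_lift, mink_hom] at h
  field_simp at h
  have : dist P Q ^ 2 = 0 := by linarith
  exact dist_eq_zero.mp (pow_eq_zero_iff two_ne_zero |>.mp this)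

theorem one_lt_mink {P Q : ℂ} (hP : P ∈ hPlane) (hQ : Q ∈ hPlane) (h : P ≠ Q) :
    1 < mink (lift P) (lift Q) :=
  lt_of_le_of_ne (one_le_mink hP hQ) fun h1 => h (eq_of_mink_eq_one hP hQ h1.symm)

theorem lift_injOn : Set.InjOn lift hPlane := fun P hP Q hQ h =>
  eq_of_mink_eq_one hP hQ (by rw [h, mink_lift_self hQ])

theorem cosh_inj {x y : ℝ} (hx : 0 ≤ x) (hy : 0 ≤ y) (h : Real.cosh x = Real.cosh y) : x = y :=
  le_antisymm (by simpa [abs_of_nonneg, hx, hy] using Real.cosh_le_cosh.mp h.le)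
    (by simpa [abs_of_nonneg, hx, hy] using Real.cosh_le_cosh.mp h.ge)

theorem hDist_eq_iff {P Q : ℂ} {r : ℝ} (hP : P ∈ hPlane) (hQ : Q ∈ hPlane) (hr : 0 ≤ r) :
    hDist P Q = r ↔ mink (lift P) (lift Q) = Real.cosh r := by
  rw [← cosh_hDist_eq hP hQ]
  exact ⟨fun h => by rw [h], fun h => cosh_inj (hDist_nonneg hP hQ) hr h⟩

theorem sinh_hDist_sq {P Q : ℂ} (hP : P ∈ hPlane) (hQ : Q ∈ hPlane) :
    Real.sinh (hDist P Q) ^ 2 = mink (lift P) (lift Q) ^ 2 - 1 := by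
  rw [Real.sinh_sq, cosh_hDist_eq hP hQ]

theorem hDist_pos {P Q : ℂ} (hP : P ∈ hPlane) (hQ : Q ∈ hPlane) (h : P ≠ Q) : 0 < hDist P Q :=
  lt_of_le_of_ne (hDist_nonneg hP hQ) fun h0 => h (eq_of_mink_eq_one hP hQ
    (by rw [← cosh_hDist_eq hP hQ, ← h0, Real.cosh_zero]))

/-! ### h-lines as sections by space-like normals -/

/-- Perpendicular clines are the sections by space-like normals. -/
theorem isPerpCline_iff {Γ : Set ℂ} :
    IsPerpCline Γ ↔ ∃ n, mink n n < 0 ∧ Γ = {z | mink (hom z) n = 0} := by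
  constructor
  · rintro (⟨c, r, hr, hc, rfl⟩ | ⟨u, hu, rfl⟩)
    · rw [norm_sq_eq] at hc
      -- Orthogonality to the absolute, `|c|² = 1 + r²`, turns the circle's equation into a linear
      -- one in `hom z`; the normal has square `1 - |c|² = -r²`.
      refine ⟨(1, c.re, c.im), by simp only [mink]; nlinarith, ?_⟩
      ext z
      rw [mem_sphere_iff_norm, ← sq_eq_sq₀ (norm_nonneg _) hr.le, norm_sq_eq]
      simp only [mink, hom, Set.mem_ofPred_eq, Complex.sub_re, Complex.sub_im]
      constructor <;> intro h <;> nlinarith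
    · have hu' : u.re ^ 2 + u.im ^ 2 = 1 := by rw [← norm_sq_eq, hu, one_pow]
      refine ⟨(0, -u.im, u.re), by simp only [mink]; nlinarith, ?_⟩
      ext z
      simp only [Set.mem_range, mink, hom, Set.mem_ofPred_eq]
      constructor
      · rintro ⟨t, rfl⟩
        simp
        ring
      · intro h
        refine ⟨z.re * u.re + z.im * u.im, Complex.ext ?_ ?_⟩
        · rw [Complex.re_ofReal_mul]
          linear_combination z.re * hu' - u.im / 2 * h
        · rw [Complex.im_ofReal_mul]
          linear_combination z.im * hu' + u.re / 2 * h
  · rintro ⟨⟨a, b, c⟩, hn, rfl⟩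
    simp only [mink] at hn
    -- A vanishing time component gives a diameter; otherwise the cline is the circle with centre
    -- `(b/a, c/a)`.
    by_cases ha : a = 0
    · subst ha
      have hs : 0 < √(b ^ 2 + c ^ 2) := Real.sqrt_pos.mpr (by nlinarith)
      have hs2 : √(b ^ 2 + c ^ 2) ^ 2 = b ^ 2 + c ^ 2 := Real.sq_sqrt (by positivity)
      set s := √(b ^ 2 + c ^ 2)
      have hu : ‖(⟨-c / s, b / s⟩ : ℂ)‖ = 1 := by
        rw [← pow_eq_one_iff_of_nonneg (norm_nonneg _) two_ne_zero, norm_sq_eq]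
        field_simp
        linarith
      refine Or.inr ⟨⟨-c / s, b / s⟩, hu, ?_⟩
      ext z
      simp only [Set.mem_range, mink, hom, Set.mem_ofPred_eq]
      constructor
      · intro h
        refine ⟨(-c * z.re + b * z.im) / s, Complex.ext ?_ ?_⟩
        · rw [Complex.re_ofReal_mul]
          field_simp
          linear_combination (-z.re) * hs2 + b / 2 * h
        · rw [Complex.im_ofReal_mul]
          field_simp
          linear_combination (-z.im) * hs2 + c / 2 * h
      · rintro ⟨t, rfl⟩
        simp only [Complex.re_ofReal_mul, Complex.im_ofReal_mul]
        field_simp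
        ring
    · have h1 : 1 < (b / a) ^ 2 + (c / a) ^ 2 := by
        rw [div_pow, div_pow, ← add_div, one_lt_div (by positivity)]; nlinarith
      have hr : 0 < √((b / a) ^ 2 + (c / a) ^ 2 - 1) := Real.sqrt_pos.mpr (by linarith)
      have hr2 : √((b / a) ^ 2 + (c / a) ^ 2 - 1) ^ 2 = (b / a) ^ 2 + (c / a) ^ 2 - 1 :=
        Real.sq_sqrt (by linarith)
      refine Or.inl ⟨⟨b / a, c / a⟩, _, hr, by rw [hr2, norm_sq_eq]; ring, ?_⟩
      ext z
      rw [mem_sphere_iff_norm, ← sq_eq_sq₀ (norm_nonneg _) hr.le, norm_sq_eq, hr2]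
      simp only [mink, hom, Set.mem_ofPred_eq, Complex.sub_re, Complex.sub_im]
      have e : (z.re - b / a) ^ 2 + (z.im - c / a) ^ 2 - ((b / a) ^ 2 + (c / a) ^ 2 - 1) =
          ((1 + (z.re ^ 2 + z.im ^ 2)) * a - 2 * z.re * b - 2 * z.im * c) / a := by
        field_simp
        ring
      rw [← sub_eq_zero (b := (b / a) ^ 2 + (c / a) ^ 2 - 1), e, div_eq_zero_iff, or_iff_left ha]

theorem mink_hom_eq_zero_iff {W : ℂ} (hW : W ∈ hPlane) (n : ℝ × ℝ × ℝ) :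
    mink (hom W) n = 0 ↔ mink (lift W) n = 0 := by
  have := mem_hPlane_iff.mp hW
  rw [lift, mink_smul_left, mul_eq_zero, or_iff_right (by positivity)]

theorem isHLine_iff {l : Set ℂ} :
    IsHLine l ↔ ∃ n, mink n n < 0 ∧ l = {z | z ∈ hPlane ∧ mink (lift z) n = 0} := by
  have e : ∀ n, {z | mink (hom z) n = 0} ∩ hPlane = {z | z ∈ hPlane ∧ mink (lift z) n = 0} := by
    intro n
    ext z
    exact ⟨fun h => ⟨h.2, (mink_hom_eq_zero_iff h.2 n).mp h.1⟩,
      fun h => ⟨(mink_hom_eq_zero_iff h.1 n).mpr h.2, h.1⟩⟩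
  constructor
  · rintro ⟨Γ, hΓ, rfl⟩
    obtain ⟨n, hn, rfl⟩ := isPerpCline_iff.mp hΓ
    exact ⟨n, hn, e n⟩
  · rintro ⟨n, hn, rfl⟩
    exact ⟨_, isPerpCline_iff.mpr ⟨n, hn, rfl⟩, (e n).symm⟩

/-- The normal of any cline through `P` and `Q` is orthogonal to `hom P` and `hom Q`, so a third
point on it makes the determinant vanish. Using `hom` instead of `lift` lets this cover ideal
endpoints as well. -/
theorem hLine_eq {P Q : ℂ} (h : mink (cross (hom P) (hom Q)) (cross (hom P) (hom Q)) < 0) :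
    hLine P Q = {W | W ∈ hPlane ∧ mink (lift W) (cross (hom P) (hom Q)) = 0} := by
  ext W
  simp only [hLine, Set.mem_ofPred_eq]
  refine and_congr_right fun hW => ?_
  rw [← mink_hom_eq_zero_iff hW]
  constructor
  · rintro ⟨Γ, hΓ, hP, hQ, hW'⟩
    obtain ⟨n, hn, rfl⟩ := isPerpCline_iff.mp hΓ
    exact det3_eq_zero hn.ne hP hQ hW'
  · intro h0
    exact ⟨_, isPerpCline_iff.mpr ⟨_, h, rfl⟩, mink_cross_left _ _, mink_cross_right _ _, h0⟩

theorem cross_lift (P Q : ℂ) : cross (lift P) (lift Q) =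
    ((1 - (P.re ^ 2 + P.im ^ 2))⁻¹ * (1 - (Q.re ^ 2 + Q.im ^ 2))⁻¹) • cross (hom P) (hom Q) := by
  refine Prod.ext ?_ (Prod.ext ?_ ?_) <;>
  simp only [lift, cross, Prod.smul_fst, Prod.smul_snd, smul_eq_mul] <;> ring

theorem mink_cross_lift {P Q : ℂ} (hP : P ∈ hPlane) (hQ : Q ∈ hPlane) :
    mink (cross (lift P) (lift Q)) (cross (lift P) (lift Q)) = -Real.sinh (hDist P Q) ^ 2 := by
  rw [mink_cross_cross, mink_lift_self hP, mink_lift_self hQ, sinh_hDist_sq hP hQ]; ring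

/-- The h-line through two points of the h-plane. -/
theorem hLine_eq_of_mem {P Q : ℂ} (hP : P ∈ hPlane) (hQ : Q ∈ hPlane) (h : P ≠ Q) :
    hLine P Q = {W | W ∈ hPlane ∧ mink (lift W) (cross (lift P) (lift Q)) = 0} := by
  have h1 := mem_hPlane_iff.mp hP
  have h2 := mem_hPlane_iff.mp hQ
  have h3 := mink_cross_lift hP hQ
  have h4 : 0 < Real.sinh (hDist P Q) := Real.sinh_pos_iff.mpr (hDist_pos hP hQ h)
  have hk : (1 - (P.re ^ 2 + P.im ^ 2))⁻¹ * (1 - (Q.re ^ 2 + Q.im ^ 2))⁻¹ ≠ 0 := by positivity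
  rw [cross_lift, mink_smul_left, mink_smul_right, ← mul_assoc, ← sq] at h3
  rw [hLine_eq, cross_lift]
  · simp only [mink_smul_right, mul_eq_zero, hk, false_or]
  · by_contra hc
    have := mul_nonneg (sq_nonneg ((1 - (P.re ^ 2 + P.im ^ 2))⁻¹ * (1 - (Q.re ^ 2 + Q.im ^ 2))⁻¹))
      (not_lt.mp hc)
    rw [h3] at this
    have : 0 < Real.sinh (hDist P Q) ^ 2 := by positivity
    linarith

/-- Cramer's rule in the basis `lift P`, `lift Q` and their cross product: the coefficient of the
cross product is the determinant that vanishes on the h-line. -/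
theorem eq_smul_add_smul {P Q W : ℂ} (hP : P ∈ hPlane) (hQ : Q ∈ hPlane) (h : P ≠ Q)
    (hW : W ∈ hLine P Q) : ∃ α β : ℝ, lift W = α • lift P + β • lift Q := by
  rw [hLine_eq_of_mem hP hQ h] at hW
  have hd : det3 (lift P) (lift Q) (lift W) = 0 := hW.2
  set n := cross (lift P) (lift Q) with hn
  have h3 := mink_cross_lift hP hQ
  have h4 : 0 < Real.sinh (hDist P Q) := Real.sinh_pos_iff.mpr (hDist_pos hP hQ h)
  have h5 := det3_smul_eq (lift P) (lift Q) n (lift W)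
  rw [hd, zero_smul, add_zero] at h5
  have h6 : det3 (lift P) (lift Q) n = -Real.sinh (hDist P Q) ^ 2 := h3
  rw [h6] at h5
  refine ⟨-(Real.sinh (hDist P Q) ^ 2)⁻¹ * det3 (lift Q) n (lift W),
    -(Real.sinh (hDist P Q) ^ 2)⁻¹ * det3 n (lift P) (lift W), ?_⟩
  rw [mul_smul, mul_smul, ← smul_add, ← h5, smul_smul, neg_mul_neg,
    inv_mul_cancel₀ (by positivity), one_smul]

/-! ### Segments and tangency -/

/-- The h-segment as the set of nonnegative combinations. -/
theorem mem_hSegment_iff {P Q W : ℂ} (hP : P ∈ hPlane) (hQ : Q ∈ hPlane) (h : P ≠ Q) :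
    W ∈ hSegment P Q ↔ W ∈ hPlane ∧
      ∃ α β : ℝ, 0 ≤ α ∧ 0 ≤ β ∧ lift W = α • lift P + β • lift Q := by
  have key : W ∈ hPlane → ∀ α β : ℝ, lift W = α • lift P + β • lift Q →
      (hDist P W + hDist W Q = hDist P Q ↔ 0 ≤ α ∧ 0 ≤ β) := by
    intro hW α β e
    have hc := hDist_pos hP hQ h
    have hp := hDist_nonneg hP hW
    have hq := hDist_nonneg hW hQ
    have e1 := cosh_hDist_eq hP hW
    have e2 := cosh_hDist_eq hW hQ
    have e3 := cosh_hDist_eq hP hQ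
    have e4 := mink_lift_self hW
    simp only [e, mink_add_left, mink_add_right, mink_smul_left, mink_smul_right,
      mink_lift_self hP, mink_lift_self hQ, mink_comm (lift Q) (lift P), ← e3] at e1 e2 e4
    set c := hDist P Q
    set p := hDist P W
    set q := hDist W Q
    have hS : 0 < Real.sinh c := Real.sinh_pos_iff.mpr hc
    have hS2 := Real.sinh_sq c
    have hp2 := Real.sinh_sq p
    have hq2 := Real.sinh_sq q
    have hsp := Real.sinh_nonneg_iff.mpr hp
    have hsq := Real.sinh_nonneg_iff.mpr hq
    -- The coefficients are ratios of `sinh`s up to sign. Their signs then decide, through the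
    -- addition formula for `cosh`, whether lengths along the line add or subtract.
    have f1 : Real.sinh p = |β| * Real.sinh c := by
      rw [← sq_eq_sq₀ hsp (by positivity), mul_pow, sq_abs, hp2, hS2, e1]
      linear_combination e4
    have f2 : Real.sinh q = |α| * Real.sinh c := by
      rw [← sq_eq_sq₀ hsq (by positivity), mul_pow, sq_abs, hq2, hS2, e2]
      linear_combination e4
    have a1 : 0 ≤ β → q = |c - p| := fun hb => cosh_inj hq (abs_nonneg _) (by
      rw [Real.cosh_abs, Real.cosh_sub, f1, abs_of_nonneg hb, e1, e2]
      linear_combination β * hS2)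
    have a2 : β ≤ 0 → q = c + p := fun hb => cosh_inj hq (by positivity) (by
      rw [Real.cosh_add, f1, abs_of_nonpos hb, e1, e2]
      linear_combination β * hS2)
    have b1 : 0 ≤ α → p = |c - q| := fun hb => cosh_inj hp (abs_nonneg _) (by
      rw [Real.cosh_abs, Real.cosh_sub, f2, abs_of_nonneg hb, e1, e2]
      linear_combination α * hS2)
    have b2 : α ≤ 0 → p = c + q := fun hb => cosh_inj hp (by positivity) (by
      rw [Real.cosh_add, f2, abs_of_nonpos hb, e1, e2]
      linear_combination α * hS2)
    constructor
    · intro hpq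
      constructor
      · by_contra hα
        have := b2 (not_le.mp hα).le
        have hq0 : q = 0 := by linarith
        rw [hq0, Real.sinh_zero] at f2
        have : 0 < |α| := abs_pos.mpr (not_le.mp hα).ne
        nlinarith
      · by_contra hβ
        have := a2 (not_le.mp hβ).le
        have hp0 : p = 0 := by linarith
        rw [hp0, Real.sinh_zero] at f1
        have : 0 < |β| := abs_pos.mpr (not_le.mp hβ).ne
        nlinarith
    · rintro ⟨hα, hβ⟩
      have h1 := a1 hβ
      have h2 := b1 hα
      rcases abs_cases (c - p) with h3 | h3 <;> rcases abs_cases (c - q) with h4 | h4 <;> linarith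
  constructor
  · rintro ⟨hl, hd⟩
    obtain ⟨α, β, e⟩ := eq_smul_add_smul hP hQ h hl
    obtain ⟨h1, h2⟩ := (key hl.1 α β e).mp hd
    exact ⟨hl.1, α, β, h1, h2, e⟩
  · rintro ⟨hW, α, β, h1, h2, e⟩
    refine ⟨?_, (key hW α β e).mpr ⟨h1, h2⟩⟩
    rw [hLine_eq_of_mem hP hQ h]
    exact ⟨hW, by rw [e, mink_add_left, mink_smul_left, mink_smul_left, mink_cross_left,
      mink_cross_right]; ring⟩

/-- An h-circle that meets an h-line in exactly one point meets it in the orthogonal projection of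
its centre. -/
theorem hCircle_inter_eq_singleton_iff {n : ℝ × ℝ × ℝ} {m : ℝ} (hm : 0 < m)
    (hn : mink n n = -m ^ 2) {I T : ℂ} {r : ℝ} (hI : I ∈ hPlane) :
    hCircle I r ∩ {W | W ∈ hPlane ∧ mink (lift W) n = 0} = {T} ↔
      0 ≤ r ∧ Real.sinh r * m = |mink (lift I) n| ∧ T ∈ hPlane ∧
        Real.cosh r • lift T = lift I + (mink (lift I) n / m ^ 2) • n := by
  set σ := mink (lift I) n with hσ
  have hII := mink_lift_self hI
  constructor
  · intro h
    have hT : T ∈ hCircle I r ∩ {W | W ∈ hPlane ∧ mink (lift W) n = 0} := by rw [h]; rfl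
    obtain ⟨⟨hT, hTr⟩, -, hTn⟩ := hT
    have hr : 0 ≤ r := hTr ▸ hDist_nonneg hI hT
    rw [hDist_eq_iff hI hT hr] at hTr
    -- `J` is the orthogonal projection of `I` onto the plane of the line; normalised, it is the
    -- foot `F`.
    set J := lift I + (σ / m ^ 2) • n with hJ
    have hJn : mink J n = 0 := by
      rw [hJ, mink_add_left, mink_smul_left, hn, ← hσ]; field_simp; ring
    have hJv : ∀ v, mink v n = 0 → mink (lift I) v = mink J v := fun v hv => by
      rw [hJ, mink_add_left, mink_smul_left, mink_comm n, hv, mul_zero, add_zero]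
    have hJI : mink J (lift I) = 1 + σ ^ 2 / m ^ 2 := by
      rw [hJ, mink_add_left, mink_smul_left, mink_comm n, hII, ← hσ]; ring
    have hJJ : mink J J = 1 + σ ^ 2 / m ^ 2 := by rw [← hJv J hJn, mink_comm, hJI]
    have hpos : 0 < 1 + σ ^ 2 / m ^ 2 := by positivity
    have hJ1 : 0 < J.1 := fst_pos (by rwa [hJJ]) (by rw [hII]; exact one_pos) (lift_fst_pos hI)
      (by rwa [hJI])
    set k := √(1 + σ ^ 2 / m ^ 2)
    have hk : 0 < k := Real.sqrt_pos.mpr hpos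
    have hk2 : k ^ 2 = 1 + σ ^ 2 / m ^ 2 := Real.sq_sqrt hpos.le
    obtain ⟨F, hF, hFe⟩ := exists_lift_eq (v := k⁻¹ • J)
      (by rw [mink_smul_left, mink_smul_right, hJJ, ← hk2]; field_simp)
      (by rw [Prod.smul_fst, smul_eq_mul]; positivity)
    have hFn : mink (lift F) n = 0 := by rw [hFe, mink_smul_left, hJn, mul_zero]
    have hc := one_le_mink hF hT
    have hFF := mink_lift_self hF
    have hTT := mink_lift_self hT
    -- The reflection of `T` in `F` has the same product with `F`, hence the same distance from `I`.
    -- Since the intersection is a single point, `T` is fixed by this reflection, so `T = F`.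
    have hrefl : mink ((2 * mink (lift F) (lift T)) • lift F - lift T)
        ((2 * mink (lift F) (lift T)) • lift F - lift T) = 1 := by
      simp only [mink_sub_left, mink_sub_right, mink_smul_left, mink_smul_right, hFF, hTT,
        mink_comm (lift T) (lift F)]
      ring
    obtain ⟨T', hT', hTe⟩ := exists_lift_eq hrefl (fst_pos (u := lift F)
      (by rw [hrefl]; exact one_pos)
      (by rw [hFF]; exact one_pos) (lift_fst_pos hF) (by
        rw [mink_sub_left, mink_smul_left, hFF, mink_comm (lift T)]; linarith))
    have hT'n : mink (lift T') n = 0 := by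
      rw [hTe, mink_sub_left, mink_smul_left, hFn, hTn]; ring
    have hIF : ∀ v, mink v n = 0 → mink (lift I) v = k * mink (lift F) v := fun v hv => by
      rw [hJv v hv, hFe, mink_smul_left]; field_simp
    have hT'm : T' ∈ hCircle I r ∩ {W | W ∈ hPlane ∧ mink (lift W) n = 0} := by
      refine ⟨⟨hT', ?_⟩, hT', hT'n⟩
      rw [hDist_eq_iff hI hT' hr, ← hTr, hIF _ hT'n, hIF _ hTn, hTe, mink_sub_right,
        mink_smul_right, hFF]
      ring
    rw [h, Set.mem_singleton_iff] at hT'm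
    rw [hT'm] at hTe
    have h2 : lift T = mink (lift F) (lift T) • lift F := by
      have : (2 : ℝ) • lift T = (2 : ℝ) • (mink (lift F) (lift T) • lift F) := by
        rw [smul_smul, two_smul]; nth_rw 1 [hTe]; abel
      exact smul_right_injective _ two_ne_zero this
    have h3 : mink (lift F) (lift T) = 1 := by
      have h4 := hTT
      rw [h2, mink_smul_left, mink_smul_right, hFF] at h4
      nlinarith
    have h4 : Real.cosh r = k := by rw [← hTr, hIF _ hTn, h3, mul_one]
    refine ⟨hr, ?_, hT, ?_⟩
    · rw [← sq_eq_sq₀ (mul_nonneg (Real.sinh_nonneg_iff.mpr hr) hm.le) (abs_nonneg _), mul_pow,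
        Real.sinh_sq, h4, hk2, sq_abs]
      field_simp
      ring
    · rw [h2, h3, one_smul, hFe, h4, smul_smul, mul_inv_cancel₀ hk.ne', one_smul]
  · rintro ⟨hr, hs, hT, e⟩
    have hch := Real.cosh_pos r
    have hs2 : Real.sinh r ^ 2 = σ ^ 2 / m ^ 2 := by
      rw [eq_div_iff (by positivity), ← mul_pow, hs, sq_abs]
    have hv : ∀ v, Real.cosh r * mink (lift T) v = mink (lift I) v + σ / m ^ 2 * mink n v :=
      fun v => by rw [← mink_smul_left, e, mink_add_left, mink_smul_left]
    have hTn : mink (lift T) n = 0 := by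
      have := hv n
      rw [hn, ← hσ] at this
      have h0 : Real.cosh r * mink (lift T) n = 0 := by rw [this]; field_simp; ring
      exact (mul_eq_zero.mp h0).resolve_left hch.ne'
    have hTI : mink (lift I) (lift T) = Real.cosh r := by
      have h0 := hv (lift I)
      rw [hII, mink_comm n, ← hσ, mink_comm] at h0
      have h1 : Real.cosh r * mink (lift I) (lift T) = Real.cosh r * Real.cosh r := by
        rw [h0, ← sq, Real.cosh_sq, hs2]; ring
      exact mul_left_cancel₀ hch.ne' h1
    ext W
    constructor
    · rintro ⟨⟨hW, hWr⟩, -, hWn⟩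
      rw [hDist_eq_iff hI hW hr] at hWr
      have h0 := hv (lift W)
      rw [hWr, mink_comm n, hWn, mul_zero, add_zero] at h0
      have := mul_left_cancel₀ hch.ne' (h0.trans (mul_one _).symm)
      exact (eq_of_mink_eq_one hT hW this).symm
    · rintro rfl
      exact ⟨⟨hT, (hDist_eq_iff hI hT hr).mpr hTI⟩, hT, hTn⟩

/-- The projection of `I` onto the plane has square `1 + σ²/m² = cosh² r`, so dividing by `cosh r`
returns it to the hyperboloid. -/
theorem exists_projection {n : ℝ × ℝ × ℝ} {m : ℝ} (hm : 0 < m) (hn : mink n n = -m ^ 2) {I : ℂ}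
    {r : ℝ} (hI : I ∈ hPlane) (hs : Real.sinh r * m = |mink (lift I) n|) :
    ∃ T ∈ hPlane, Real.cosh r • lift T = lift I + (mink (lift I) n / m ^ 2) • n := by
  set σ := mink (lift I) n with hσ
  have hII := mink_lift_self hI
  have hch := Real.cosh_pos r
  have hs2 : Real.sinh r ^ 2 = σ ^ 2 / m ^ 2 := by
    rw [eq_div_iff (by positivity), ← mul_pow, hs, sq_abs]
  have h1 : mink (lift I + (σ / m ^ 2) • n) (lift I + (σ / m ^ 2) • n) = Real.cosh r ^ 2 := by
    simp only [mink_add_left, mink_add_right, mink_smul_left, mink_smul_right, hn,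
      mink_comm n (lift I), ← hσ, hII]
    rw [Real.cosh_sq, hs2]
    field_simp
    ring
  have h2 : 0 < mink (lift I + (σ / m ^ 2) • n) (lift I) := by
    simp only [mink_add_left, mink_smul_left, mink_comm n (lift I), ← hσ, hII]
    rw [div_mul_eq_mul_div, ← sq]
    positivity
  have h3 := fst_pos (by rw [h1]; positivity) (by rw [hII]; exact one_pos) (lift_fst_pos hI) h2
  obtain ⟨T, hT, e⟩ := exists_lift_eq
    (v := (Real.cosh r)⁻¹ • (lift I + (σ / m ^ 2) • n))
    (by rw [mink_smul_left, mink_smul_right, h1]; field_simp)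
    (by rw [Prod.smul_fst, smul_eq_mul]; positivity)
  exact ⟨T, hT, by rw [e, smul_smul, mul_inv_cancel₀ hch.ne', one_smul]⟩

theorem isTangentToLine_iff {n : ℝ × ℝ × ℝ} {m : ℝ} (hm : 0 < m)
    (hn : mink n n = -m ^ 2) {I : ℂ} {r : ℝ} (hI : I ∈ hPlane) (hr : 0 < r) :
    IsTangentToLine I r {W | W ∈ hPlane ∧ mink (lift W) n = 0} ↔
      Real.sinh r * m = |mink (lift I) n| := by
  simp only [IsTangentToLine, hCircle_inter_eq_singleton_iff hm hn hI]
  constructor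
  · rintro ⟨T, -, h, -⟩
    exact h
  · intro h
    obtain ⟨T, hT, e⟩ := exists_projection hm hn hI h
    exact ⟨T, hr.le, h, hT, e⟩

/-- The equation puts the line at distance `r` from `I`. The two inequalities are the signs of the
coefficients of the contact point in `lift X`, `lift Y`, scaled by the positive factor `cosh r *
(mink (lift X) (lift Y) ^ 2 - 1)`. -/
theorem isTangentToSegment_iff {X Y I : ℂ} {r : ℝ} (hX : X ∈ hPlane) (hY : Y ∈ hPlane)
    (hXY : X ≠ Y) (hI : I ∈ hPlane) (hr : 0 < r) :
    IsTangentToSegment I r X Y ↔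
      Real.sinh r * Real.sinh (hDist X Y) = |det3 (lift X) (lift Y) (lift I)| ∧
      mink (lift I) (lift X) ≤ mink (lift X) (lift Y) * mink (lift I) (lift Y) ∧
      mink (lift I) (lift Y) ≤ mink (lift X) (lift Y) * mink (lift I) (lift X) := by
  have hm : 0 < Real.sinh (hDist X Y) := Real.sinh_pos_iff.mpr (hDist_pos hX hY hXY)
  have hn := mink_cross_lift hX hY
  have hC := one_lt_mink hX hY hXY
  have hch := Real.cosh_pos r
  simp only [IsTangentToSegment, hLine_eq_of_mem hX hY hXY,
    hCircle_inter_eq_singleton_iff hm hn hI]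
  have key : ∀ T, ∀ α β : ℝ, lift T = α • lift X + β • lift Y →
      Real.cosh r • lift T = lift I + (mink (lift I) (cross (lift X) (lift Y)) /
        Real.sinh (hDist X Y) ^ 2) • cross (lift X) (lift Y) →
      Real.cosh r * (mink (lift X) (lift Y) ^ 2 - 1) * α =
        mink (lift X) (lift Y) * mink (lift I) (lift Y) - mink (lift I) (lift X) ∧
      Real.cosh r * (mink (lift X) (lift Y) ^ 2 - 1) * β =
        mink (lift X) (lift Y) * mink (lift I) (lift X) - mink (lift I) (lift Y) := by
    intro T α β hT e
    have e1 := congrArg (fun v => mink v (lift X)) e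
    have e2 := congrArg (fun v => mink v (lift Y)) e
    simp only [hT, mink_add_left, mink_smul_left, mink_comm (cross _ _), mink_cross_left,
      mink_cross_right, mink_lift_self hX, mink_lift_self hY, mink_comm (lift Y) (lift X)] at e1 e2
    constructor
    · linear_combination (mink (lift X) (lift Y)) * e2 - e1
    · linear_combination (mink (lift X) (lift Y)) * e1 - e2
  have hC2 : 0 < Real.cosh r * (mink (lift X) (lift Y) ^ 2 - 1) := mul_pos hch (by nlinarith)
  constructor
  · rintro ⟨T, hTs, -, hs, hT, e⟩
    obtain ⟨-, α, β, hα, hβ, hTe⟩ := (mem_hSegment_iff hX hY hXY).mp hTs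
    obtain ⟨k1, k2⟩ := key T α β hTe e
    have := mul_nonneg hC2.le hα
    have := mul_nonneg hC2.le hβ
    exact ⟨hs, by linarith, by linarith⟩
  · rintro ⟨hs, h1, h2⟩
    obtain ⟨T, hT, e⟩ := exists_projection hm hn hI hs
    have hTl : T ∈ hLine X Y := by
      have := (hCircle_inter_eq_singleton_iff hm hn hI).mpr ⟨hr.le, hs, hT, e⟩
      rw [hLine_eq_of_mem hX hY hXY]
      exact (this.ge rfl).2
    obtain ⟨α, β, hTe⟩ := eq_smul_add_smul hX hY hXY hTl
    obtain ⟨k1, k2⟩ := key T α β hTe e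
    refine ⟨T, (mem_hSegment_iff hX hY hXY).mpr ⟨hT, α, β, ?_, ?_, hTe⟩, hr.le, hs, hT, e⟩
    · exact nonneg_of_mul_nonneg_right (by linarith) hC2
    · exact nonneg_of_mul_nonneg_right (by linarith) hC2

theorem isHTriangle_iff {X Y Z : ℂ} : IsHTriangle X Y Z ↔
    X ∈ hPlane ∧ Y ∈ hPlane ∧ Z ∈ hPlane ∧ det3 (lift X) (lift Y) (lift Z) ≠ 0 := by
  simp only [IsHTriangle]
  refine and_congr_right fun hX => and_congr_right fun hY => and_congr_right fun hZ => ?_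
  rw [not_iff_not]
  constructor
  · rintro ⟨l, hl, h1, h2, h3⟩
    obtain ⟨n, hn, rfl⟩ := isHLine_iff.mp hl
    exact det3_eq_zero hn.ne h1.2 h2.2 h3.2
  · intro h
    -- For coinciding vertices the cross product is zero and is not a normal; any cline through the
    -- two remaining points serves.
    by_cases hXY : X = Y
    · obtain ⟨Γ, hΓ, h1, h2⟩ := exists_perpCline (Q := Z) hX
      exact ⟨_, ⟨Γ, hΓ, rfl⟩, ⟨h1, hX⟩, hXY ▸ ⟨h1, hX⟩, ⟨h2, hZ⟩⟩
    · have hm : 0 < Real.sinh (hDist X Y) := Real.sinh_pos_iff.mpr (hDist_pos hX hY hXY)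
      exact ⟨_, isHLine_iff.mpr ⟨cross (lift X) (lift Y),
        by rw [mink_cross_lift hX hY]; simpa using pow_pos hm 2, rfl⟩,
        ⟨hX, mink_cross_left _ _⟩, ⟨hY, mink_cross_right _ _⟩, ⟨hZ, h⟩⟩

/-! ### The incircle of an h-triangle -/

/-- A point of the hyperboloid on a given line through the origin, and its height, are unique. -/
theorem eq_of_smul_lift_eq {I J : ℂ} {r s D t u : ℝ} {S : ℝ × ℝ × ℝ} (hI : I ∈ hPlane)
    (hJ : J ∈ hPlane) (hD : D ≠ 0) (ht : |t| = Real.sinh r)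
    (hu : |u| = Real.sinh s) (h1 : D • lift I = t • S) (h2 : D • lift J = u • S) :
    I = J ∧ r = s := by
  have a1 : D ^ 2 = t ^ 2 * mink S S := by
    have := congrArg (fun v => mink v v) h1
    simp only [mink_smul_left, mink_smul_right, mink_lift_self hI] at this
    linarith
  have a2 : D ^ 2 = u ^ 2 * mink S S := by
    have := congrArg (fun v => mink v v) h2
    simp only [mink_smul_left, mink_smul_right, mink_lift_self hJ] at this
    linarith
  have hD2 : D ^ 2 ≠ 0 := pow_ne_zero 2 hD
  have hS : mink S S ≠ 0 := fun h0 => hD2 (by rw [a1, h0, mul_zero])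
  have htu : |t| = |u| := (sq_eq_sq_iff_abs_eq_abs _ _).mp (mul_right_cancel₀ hS (a1.symm.trans a2))
  have hrs : r = s := Real.sinh_injective (by rw [← ht, ← hu, htu])
  refine ⟨?_, hrs⟩
  have a3 : D ^ 2 * mink (lift I) (lift J) = t * u * mink S S := by
    have : mink (D • lift I) (D • lift J) = mink (t • S) (u • S) := by rw [h1, h2]
    simp only [mink_smul_left, mink_smul_right] at this
    linarith
  have hIJ := one_le_mink hI hJ
  rcases abs_eq_abs.mp htu with h | h
  · exact eq_of_mink_eq_one hI hJ (mul_left_cancel₀ hD2 (by rw [a3, h, a2]; ring))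
  -- Opposite signs would make the product of two lifted points `-1`, although it is at least 1.
  · have : D ^ 2 * mink (lift I) (lift J) = D ^ 2 * (-1) := by rw [a3, h, a2]; ring
    linarith [mul_left_cancel₀ hD2 this]

/-- The weighted sum of the vertices of an h-triangle over its incentre. -/
noncomputable def incenterVec (X Y Z : ℂ) : ℝ × ℝ × ℝ :=
  Real.sinh (hDist Y Z) • lift X + Real.sinh (hDist Z X) • lift Y + Real.sinh (hDist X Y) • lift Z

/-- The difference `(A² - 1)(C² - 1) - (AC - B)²` is the Gram determinant. -/
theorem mul_sub_sq_lt {A B C : ℝ} (h : 0 < 1 + 2 * A * B * C - A ^ 2 - B ^ 2 - C ^ 2) {a c : ℝ}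
    (ha : 0 ≤ a) (hc : 0 ≤ c) (ha2 : a ^ 2 = A ^ 2 - 1) (hc2 : c ^ 2 = C ^ 2 - 1) :
    |A * C - B| < a * c := by
  refine abs_lt_of_sq_lt_sq ?_ (by positivity)
  rw [mul_pow, ha2, hc2]
  linarith

theorem det3_lift_sq {X Y Z : ℂ} (hX : X ∈ hPlane) (hY : Y ∈ hPlane) (hZ : Z ∈ hPlane) :
    det3 (lift X) (lift Y) (lift Z) ^ 2 = 1 + 2 * mink (lift Y) (lift Z) * mink (lift Z) (lift X) *
      mink (lift X) (lift Y) - mink (lift Y) (lift Z) ^ 2 - mink (lift Z) (lift X) ^ 2 -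
      mink (lift X) (lift Y) ^ 2 := by
  rw [det3_sq, mink_lift_self hX, mink_lift_self hY, mink_lift_self hZ]
  ring

/-- The triangle inequalities at one side of a nondegenerate h-triangle, in multiplicative form. -/
theorem abs_mul_sub_lt {X Y Z : ℂ} (hX : X ∈ hPlane) (hY : Y ∈ hPlane) (hZ : Z ∈ hPlane)
    (hD : det3 (lift X) (lift Y) (lift Z) ≠ 0) :
    |mink (lift Y) (lift Z) * mink (lift X) (lift Y) - mink (lift Z) (lift X)| <
      Real.sinh (hDist Y Z) * Real.sinh (hDist X Y) :=
  mul_sub_sq_lt (by rw [← det3_lift_sq hX hY hZ]; positivity)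
    (Real.sinh_nonneg_iff.mpr (hDist_nonneg hY hZ)) (Real.sinh_nonneg_iff.mpr (hDist_nonneg hX hY))
    (sinh_hDist_sq hY hZ) (sinh_hDist_sq hX hY)

theorem ne_of_det3_ne_zero {X Y Z : ℂ} (hD : det3 (lift X) (lift Y) (lift Z) ≠ 0) : X ≠ Y := by
  rintro rfl
  exact hD (by simp only [det3, mink, cross]; ring)

/-- Turns tangency into membership in a fixed line through the origin. Tangency to the sides only
gives the Cramer coefficients of `I` up to three signs. The strict triangle inequalities make the
position of each contact point depend on these signs alone, and forces them to agree. -/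
theorem isHIncircle_iff {X Y Z I : ℂ} {r : ℝ} (h : IsHTriangle X Y Z) :
    IsHIncircle X Y Z I r ↔ I ∈ hPlane ∧ 0 < r ∧ ∃ t, |t| = Real.sinh r ∧
      det3 (lift X) (lift Y) (lift Z) • lift I = t • incenterVec X Y Z := by
  obtain ⟨hX, hY, hZ, hD⟩ := isHTriangle_iff.mp h
  have hD1 : det3 (lift Y) (lift Z) (lift X) ≠ 0 := by rwa [det3_rotate]
  have hD2 : det3 (lift Z) (lift X) (lift Y) ≠ 0 := by rwa [det3_rotate]
  have hXY := ne_of_det3_ne_zero hD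
  have i1 := abs_mul_sub_lt hX hY hZ hD
  have hYZ := ne_of_det3_ne_zero hD1
  have i2 := abs_mul_sub_lt hY hZ hX hD1
  have hZX := ne_of_det3_ne_zero hD2
  have i3 := abs_mul_sub_lt hZ hX hY hD2
  have hA1 := one_lt_mink hY hZ hYZ
  have hB1 := one_lt_mink hZ hX hZX
  have hC1 := one_lt_mink hX hY hXY
  have ha : 0 < Real.sinh (hDist Y Z) := Real.sinh_pos_iff.mpr (hDist_pos hY hZ hYZ)
  have hb : 0 < Real.sinh (hDist Z X) := Real.sinh_pos_iff.mpr (hDist_pos hZ hX hZX)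
  have hc : 0 < Real.sinh (hDist X Y) := Real.sinh_pos_iff.mpr (hDist_pos hX hY hXY)
  have ha2 := sinh_hDist_sq hY hZ
  have hb2 := sinh_hDist_sq hZ hX
  have hc2 := sinh_hDist_sq hX hY
  refine and_congr_right fun hI => and_congr_right fun hr => ?_
  have hs : 0 < Real.sinh r := Real.sinh_pos_iff.mpr hr
  rw [isTangentToSegment_iff hX hY hXY hI hr, isTangentToSegment_iff hY hZ hYZ hI hr,
    isTangentToSegment_iff hZ hX hZX hI hr, incenterVec]
  have hmX := mink_lift_self hX
  have hmY := mink_lift_self hY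
  have hmZ := mink_lift_self hZ
  have hIX := one_le_mink hI hX
  have cr := det3_smul_eq (lift X) (lift Y) (lift Z) (lift I)
  set D := det3 (lift X) (lift Y) (lift Z) with hDdef
  set A := mink (lift Y) (lift Z)
  set B := mink (lift Z) (lift X)
  set C := mink (lift X) (lift Y)
  set a := Real.sinh (hDist Y Z)
  set b := Real.sinh (hDist Z X)
  set c := Real.sinh (hDist X Y)
  set s := Real.sinh r
  have prods : ∀ u v w : ℝ, D • lift I = u • lift X + v • lift Y + w • lift Z →
      D * mink (lift I) (lift X) = u + v * C + w * B ∧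
      D * mink (lift I) (lift Y) = u * C + v + w * A ∧
      D * mink (lift I) (lift Z) = u * B + v * A + w := by
    intro u v w e
    simp only [← mink_smul_left, e]
    simp only [mink_add_left, mink_smul_left, mink_comm (lift Y) (lift X),
      mink_comm (lift Z) (lift Y), mink_comm (lift X) (lift Z), hmX, hmY, hmZ]
    refine ⟨?_, ?_, ?_⟩ <;> ring
  rw [abs_lt] at i1 i2 i3
  constructor
  · rintro ⟨⟨t3, p1, p2⟩, ⟨t1, q1, q2⟩, ⟨t2, -, -⟩⟩
    obtain ⟨k1, k2, k3⟩ := prods _ _ _ cr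
    -- The two segment conditions are multiplied together so that the unknown sign of `D` enters
    -- only as `D²`.
    have n1 : 0 ≤ (D * (C * mink (lift I) (lift Y) - mink (lift I) (lift X))) *
        (D * (C * mink (lift I) (lift X) - mink (lift I) (lift Y))) := by
      have := mul_nonneg (mul_nonneg (sub_nonneg.mpr p1) (sub_nonneg.mpr p2)) (sq_nonneg D)
      linarith
    have n2 : 0 ≤ (D * (A * mink (lift I) (lift Z) - mink (lift I) (lift Y))) *
        (D * (A * mink (lift I) (lift Y) - mink (lift I) (lift Z))) := by
      have := mul_nonneg (mul_nonneg (sub_nonneg.mpr q1) (sub_nonneg.mpr q2)) (sq_nonneg D)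
      linarith
    -- By `i1`, `i2`, `i3` each factor has the sign of its leading term: the first product is
    -- nonnegative only if `e1 = e2`, the second only if `e2 = e3`.
    have red : ∀ e1 e2 e3 : ℝ, det3 (lift Y) (lift Z) (lift I) = e1 * (s * a) →
        det3 (lift Z) (lift X) (lift I) = e2 * (s * b) →
        det3 (lift X) (lift Y) (lift I) = e3 * (s * c) →
        0 ≤ (e1 * (a * c) + e3 * (A * C - B)) * (e2 * (b * c) + e3 * (C * B - A)) ∧
        0 ≤ (e2 * (b * a) + e1 * (B * A - C)) * (e3 * (c * a) + e1 * (A * C - B)) := by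
      intro e1 e2 e3 h1 h2 h3
      rw [h1, h2, h3] at k1 k2 k3
      have hsc : 0 < (s * c) ^ 2 := by positivity
      have hsa : 0 < (s * a) ^ 2 := by positivity
      constructor
      · refine nonneg_of_mul_nonneg_right (a := (s * c) ^ 2) (le_of_le_of_eq n1 ?_) hsc
        rw [show D * (C * mink (lift I) (lift Y) - mink (lift I) (lift X)) =
            (s * c) * (e1 * (a * c) + e3 * (A * C - B)) by
              linear_combination C * k2 - k1 - e1 * s * a * hc2,
          show D * (C * mink (lift I) (lift X) - mink (lift I) (lift Y)) =
            (s * c) * (e2 * (b * c) + e3 * (C * B - A)) by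
              linear_combination C * k1 - k2 - e2 * s * b * hc2]
        ring
      · refine nonneg_of_mul_nonneg_right (a := (s * a) ^ 2) (le_of_le_of_eq n2 ?_) hsa
        rw [show D * (A * mink (lift I) (lift Z) - mink (lift I) (lift Y)) =
            (s * a) * (e2 * (b * a) + e1 * (B * A - C)) by
              linear_combination A * k3 - k2 - e2 * s * b * ha2,
          show D * (A * mink (lift I) (lift Y) - mink (lift I) (lift Z)) =
            (s * a) * (e3 * (c * a) + e1 * (A * C - B)) by
              linear_combination A * k2 - k3 - e3 * s * c * ha2]
        ring
    have fin : ∀ e : ℝ, |e| = 1 → det3 (lift Y) (lift Z) (lift I) = e * (s * a) →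
        det3 (lift Z) (lift X) (lift I) = e * (s * b) →
        det3 (lift X) (lift Y) (lift I) = e * (s * c) → ∃ t, |t| = s ∧
          D • lift I = t • (a • lift X + b • lift Y + c • lift Z) := by
      intro e he h1 h2 h3
      refine ⟨e * s, by rw [abs_mul, he, one_mul, abs_of_pos hs], ?_⟩
      rw [cr, h1, h2, h3]
      simp only [smul_add, smul_smul, mul_assoc]
    have sgn : ∀ d x : ℝ, 0 < x → s * x = |d| → d = 1 * (s * x) ∨ d = (-1) * (s * x) := by
      intro d x hx h
      rcases abs_eq (mul_pos hs hx).le |>.mp h.symm with h | h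
      · left; rw [h, one_mul]
      · right; rw [h]; ring
    have neg : ∀ x y : ℝ, x < 0 → 0 < y → ¬ 0 ≤ x * y := fun x y hx hy => by
      have := mul_neg_of_neg_of_pos hx hy
      linarith
    have neg' : ∀ x y : ℝ, 0 < x → y < 0 → ¬ 0 ≤ x * y := fun x y hx hy => by
      have := mul_neg_of_pos_of_neg hx hy
      linarith
    rcases sgn _ _ ha t1 with h1 | h1 <;> rcases sgn _ _ hb t2 with h2 | h2 <;>
      rcases sgn _ _ hc t3 with h3 | h3
    · exact fin 1 (by simp) h1 h2 h3
    · exact absurd (red _ _ _ h1 h2 h3).2 (neg' _ _ (by linarith) (by linarith))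
    · exact absurd (red _ _ _ h1 h2 h3).1 (neg' _ _ (by linarith) (by linarith))
    · exact absurd (red _ _ _ h1 h2 h3).1 (neg' _ _ (by linarith) (by linarith))
    · exact absurd (red _ _ _ h1 h2 h3).1 (neg _ _ (by linarith) (by linarith))
    · exact absurd (red _ _ _ h1 h2 h3).1 (neg _ _ (by linarith) (by linarith))
    · exact absurd (red _ _ _ h1 h2 h3).2 (neg _ _ (by linarith) (by linarith))
    · exact fin (-1) (by simp) h1 h2 h3
  · rintro ⟨t, ht, e⟩
    rw [smul_add, smul_add, smul_smul, smul_smul, smul_smul] at e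
    obtain ⟨k1, k2, k3⟩ := prods _ _ _ e
    -- `t` has the sign of `D`, since `I` and the positive combination of the vertices must lie on
    -- the same sheet.
    have hDt : 0 < D * t := by
      have h1 : D * t * (a + b * C + c * B) = D ^ 2 * mink (lift I) (lift X) := by
        linear_combination (-D) * k1
      have h2 : 0 < a + b * C + c * B := by positivity
      have h3 : 0 < D ^ 2 * mink (lift I) (lift X) := by positivity
      exact pos_of_mul_pos_left (h1 ▸ h3) h2.le
    have d1 : det3 (lift Y) (lift Z) (lift I) = t * a := by
      have := congrArg (fun v => det3 (lift Y) (lift Z) v) e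
      simp only [det3, mink_add_left, mink_smul_left, mink_cross_left, mink_cross_right] at this
      have h1 : mink (lift X) (cross (lift Y) (lift Z)) = D := det3_rotate _ _ _
      rw [h1] at this
      exact mul_left_cancel₀ hD (by simp only [det3]; linarith)
    have d2 : det3 (lift Z) (lift X) (lift I) = t * b := by
      have := congrArg (fun v => det3 (lift Z) (lift X) v) e
      simp only [det3, mink_add_left, mink_smul_left, mink_cross_left, mink_cross_right] at this
      have h1 : mink (lift Y) (cross (lift Z) (lift X)) = D := (det3_rotate _ _ _).symm
      rw [h1] at this
      exact mul_left_cancel₀ hD (by simp only [det3]; linarith)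
    have d3 : det3 (lift X) (lift Y) (lift I) = t * c := by
      have := congrArg (fun v => det3 (lift X) (lift Y) v) e
      simp only [det3, mink_add_left, mink_smul_left, mink_cross_left, mink_cross_right] at this
      have h1 : mink (lift Z) (cross (lift X) (lift Y)) = D := rfl
      rw [h1] at this
      exact mul_left_cancel₀ hD (by simp only [det3]; linarith)
    have hDD : 0 < D ^ 2 := by positivity
    have fin : ∀ u v w : ℝ, 0 < v → 0 < w → D ^ 2 * u = D * t * v * w → 0 ≤ u :=
      fun u v w hv hw h => nonneg_of_mul_nonneg_right (h ▸ by positivity) hDD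
    refine ⟨⟨?_, ?_, ?_⟩, ⟨?_, ?_, ?_⟩, ⟨?_, ?_, ?_⟩⟩
    · rw [d3, abs_mul, ht, abs_of_pos hc]
    · refine sub_nonneg.mp (fin _ c (a * c + (A * C - B)) hc (by linarith) ?_)
      linear_combination D * (C * k2 - k1 - t * a * hc2)
    · refine sub_nonneg.mp (fin _ c (b * c + (C * B - A)) hc (by linarith) ?_)
      linear_combination D * (C * k1 - k2 - t * b * hc2)
    · rw [d1, abs_mul, ht, abs_of_pos ha]
    · refine sub_nonneg.mp (fin _ a (b * a + (B * A - C)) ha (by linarith) ?_)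
      linear_combination D * (A * k3 - k2 - t * b * ha2)
    · refine sub_nonneg.mp (fin _ a (c * a + (A * C - B)) ha (by linarith) ?_)
      linear_combination D * (A * k2 - k3 - t * c * ha2)
    · rw [d2, abs_mul, ht, abs_of_pos hb]
    · refine sub_nonneg.mp (fin _ b (c * b + (C * B - A)) hb (by linarith) ?_)
      linear_combination D * (B * k1 - k3 - t * c * hb2)
    · refine sub_nonneg.mp (fin _ b (a * b + (B * A - C)) hb (by linarith) ?_)
      linear_combination D * (B * k3 - k1 - t * a * hb2)

/-- Existence of incircles, ordinary and ideal: the line through `S` meets the upper sheet, and the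
radius is then read off from the scaling factor. -/
theorem exists_smul_lift_eq {S : ℝ × ℝ × ℝ} (hS : 0 < mink S S) {D : ℝ} (hD : D ≠ 0) :
    ∃ I ∈ hPlane, ∃ r : ℝ, 0 < r ∧ ∃ t, |t| = Real.sinh r ∧ D • lift I = t • S := by
  obtain ⟨I, hI, k, hk⟩ := exists_lift_eq_smul hS
  have hk0 : k ≠ 0 := by
    rintro rfl
    have := mink_lift_self hI
    rw [hk, mink_smul_left, zero_mul] at this
    exact zero_ne_one this
  refine ⟨I, hI, Real.arsinh |D * k|, Real.arsinh_pos_iff.mpr (by positivity), D * k,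
    (Real.sinh_arsinh _).symm, by rw [hk, smul_smul]⟩

theorem mink_incenterVec {X Y Z : ℂ} (hX : X ∈ hPlane) (hY : Y ∈ hPlane) (hZ : Z ∈ hPlane) :
    mink (incenterVec X Y Z) (incenterVec X Y Z) =
      Real.sinh (hDist Y Z) ^ 2 + Real.sinh (hDist Z X) ^ 2 + Real.sinh (hDist X Y) ^ 2 +
      2 * (Real.sinh (hDist Y Z) * Real.sinh (hDist Z X) * Real.cosh (hDist X Y) +
        Real.sinh (hDist Z X) * Real.sinh (hDist X Y) * Real.cosh (hDist Y Z) +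
        Real.sinh (hDist X Y) * Real.sinh (hDist Y Z) * Real.cosh (hDist Z X)) := by
  rw [cosh_hDist_eq hX hY, cosh_hDist_eq hY hZ, cosh_hDist_eq hZ hX]
  simp only [incenterVec, mink_add_left, mink_add_right, mink_smul_left, mink_smul_right,
    mink_lift_self hX, mink_lift_self hY, mink_lift_self hZ, mink_comm (lift Y) (lift X),
    mink_comm (lift Z) (lift Y), mink_comm (lift X) (lift Z)]
  ring

theorem mink_incenterVec_pos {X Y Z : ℂ} (h : IsHTriangle X Y Z) :
    0 < mink (incenterVec X Y Z) (incenterVec X Y Z) := by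
  obtain ⟨hX, hY, hZ, hD⟩ := isHTriangle_iff.mp h
  have h1 := Real.sinh_pos_iff.mpr (hDist_pos hX hY (ne_of_det3_ne_zero hD))
  have h2 := Real.sinh_nonneg_iff.mpr (hDist_nonneg hY hZ)
  have h3 := Real.sinh_nonneg_iff.mpr (hDist_nonneg hZ hX)
  have h4 := Real.cosh_pos (hDist X Y)
  have h5 := Real.cosh_pos (hDist Y Z)
  have h6 := Real.cosh_pos (hDist Z X)
  rw [mink_incenterVec hX hY hZ]
  positivity

theorem existsUnique_isHIncircle {X Y Z : ℂ} (h : IsHTriangle X Y Z) :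
    ∃! p : ℂ × ℝ, IsHIncircle X Y Z p.1 p.2 := by
  have hD := (isHTriangle_iff.mp h).2.2.2
  simp only [isHIncircle_iff h]
  obtain ⟨I, hI, r, hr, t, ht, e⟩ := exists_smul_lift_eq (mink_incenterVec_pos h) hD
  refine ⟨(I, r), ⟨hI, hr, t, ht, e⟩, ?_⟩
  rintro ⟨J, s⟩ ⟨hJ, -, u, hu, e'⟩
  obtain ⟨h1, h2⟩ := eq_of_smul_lift_eq hJ hI hD hu ht e' e
  exact Prod.ext h1 h2

/-! ### Tangent lengths and the bound on the inradius -/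

/-- The Gromov product of `Y` and `Z` at `X`: the length of the tangents from `X` to the
incircle. -/
noncomputable def gromov (X Y Z : ℂ) : ℝ := (hDist X Y + hDist Z X - hDist Y Z) / 2

theorem gromov_add (X Y Z : ℂ) : gromov X Y Z + gromov Y Z X = hDist X Y := by
  simp only [gromov]; ring

/-- The strict triangle inequality: one half of `abs_mul_sub_lt` bounds the `cosh` of a side by the
`cosh` of the sum of the other two. -/
theorem gromov_pos {X Y Z : ℂ} (h : IsHTriangle X Y Z) : 0 < gromov X Y Z := by
  obtain ⟨hX, hY, hZ, hD⟩ := isHTriangle_iff.mp h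
  have hD2 : det3 (lift Z) (lift X) (lift Y) ≠ 0 := by rwa [det3_rotate, det3_rotate]
  have h1 := (abs_lt.mp (abs_mul_sub_lt hZ hX hY hD2)).1
  rw [← cosh_hDist_eq hX hY, ← cosh_hDist_eq hZ hX, ← cosh_hDist_eq hY hZ] at h1
  have h2 : Real.cosh (hDist Y Z) < Real.cosh (hDist X Y + hDist Z X) := by
    rw [Real.cosh_add]; linarith
  rw [Real.cosh_lt_cosh, abs_of_nonneg (hDist_nonneg hY hZ),
    abs_of_nonneg (add_nonneg (hDist_nonneg hX hY) (hDist_nonneg hZ hX))] at h2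
  rw [gromov]
  linarith

/-- A hyperbolic Heron formula: with sides `y + z`, `z + x`, `x + y`, the Gram determinant factors
through the half-perimeter and the tangent lengths. -/
theorem gram_cosh (x y z : ℝ) :
    1 + 2 * Real.cosh (y + z) * Real.cosh (z + x) * Real.cosh (x + y) - Real.cosh (y + z) ^ 2 -
      Real.cosh (z + x) ^ 2 - Real.cosh (x + y) ^ 2 =
    4 * Real.sinh (x + y + z) * (Real.sinh x * Real.sinh y * Real.sinh z) := by
  simp only [Real.cosh_eq, Real.sinh_eq, neg_add, Real.exp_add, Real.exp_neg]
  have := (Real.exp_pos x).ne'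
  have := (Real.exp_pos y).ne'
  have := (Real.exp_pos z).ne'
  field_simp
  ring

/-- The square of `incenterVec` in tangent lengths. It shares the factor `4 sinh (x + y + z)` with
`gram_cosh`, which cancels in the formula for the radius. -/
theorem sum_sinh_sq (x y z : ℝ) :
    Real.sinh (y + z) ^ 2 + Real.sinh (z + x) ^ 2 + Real.sinh (x + y) ^ 2 +
      2 * (Real.sinh (y + z) * Real.sinh (z + x) * Real.cosh (x + y) +
        Real.sinh (z + x) * Real.sinh (x + y) * Real.cosh (y + z) +
        Real.sinh (x + y) * Real.sinh (y + z) * Real.cosh (z + x)) =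
    4 * Real.sinh (x + y + z) *
      (Real.sinh (x + y + z) - Real.sinh x * Real.sinh y * Real.sinh z) := by
  simp only [Real.cosh_eq, Real.sinh_eq, neg_add, Real.exp_add, Real.exp_neg]
  have := (Real.exp_pos x).ne'
  have := (Real.exp_pos y).ne'
  have := (Real.exp_pos z).ne'
  field_simp
  ring

theorem det3_lift_sq_gromov {X Y Z : ℂ} (hX : X ∈ hPlane) (hY : Y ∈ hPlane) (hZ : Z ∈ hPlane) :
    det3 (lift X) (lift Y) (lift Z) ^ 2 =
      4 * Real.sinh (gromov X Y Z + gromov Y Z X + gromov Z X Y) *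
      (Real.sinh (gromov X Y Z) * Real.sinh (gromov Y Z X) * Real.sinh (gromov Z X Y)) := by
  rw [← gram_cosh, gromov_add, gromov_add, gromov_add, det3_lift_sq hX hY hZ,
    cosh_hDist_eq hX hY, cosh_hDist_eq hY hZ, cosh_hDist_eq hZ hX]

theorem isHTriangle_of_gromov_pos {X Y Z : ℂ} (hX : X ∈ hPlane) (hY : Y ∈ hPlane)
    (hZ : Z ∈ hPlane) (h1 : 0 < gromov X Y Z) (h2 : 0 < gromov Y Z X) (h3 : 0 < gromov Z X Y) :
    IsHTriangle X Y Z := by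
  refine isHTriangle_iff.mpr ⟨hX, hY, hZ, fun h0 => ?_⟩
  have h := det3_lift_sq_gromov hX hY hZ
  have k0 := Real.sinh_pos_iff.mpr (add_pos (add_pos h1 h2) h3)
  have k1 := Real.sinh_pos_iff.mpr h1
  have k2 := Real.sinh_pos_iff.mpr h2
  have k3 := Real.sinh_pos_iff.mpr h3
  rw [h0] at h
  have : 0 < 4 * Real.sinh (gromov X Y Z + gromov Y Z X + gromov Z X Y) *
      (Real.sinh (gromov X Y Z) * Real.sinh (gromov Y Z X) * Real.sinh (gromov Z X Y)) := by
    positivity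
  linarith

/-- The inradius in terms of the tangent lengths. -/
theorem sinh_inradius_sq {X Y Z I : ℂ} {r : ℝ} (h : IsHTriangle X Y Z)
    (hI : IsHIncircle X Y Z I r) :
    Real.sinh r ^ 2 * (Real.sinh (gromov X Y Z) * Real.cosh (gromov Y Z X) *
        Real.cosh (gromov Z X Y) + Real.cosh (gromov X Y Z) * Real.sinh (gromov Y Z X) *
        Real.cosh (gromov Z X Y) + Real.cosh (gromov X Y Z) * Real.cosh (gromov Y Z X) *
        Real.sinh (gromov Z X Y)) =
      Real.sinh (gromov X Y Z) * Real.sinh (gromov Y Z X) * Real.sinh (gromov Z X Y) := by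
  obtain ⟨hX, hY, hZ, hD⟩ := isHTriangle_iff.mp h
  obtain ⟨hIp, -, t, ht, e⟩ := (isHIncircle_iff h).mp hI
  have e1 := congrArg (fun v => mink v v) e
  simp only [mink_smul_left, mink_smul_right, mink_lift_self hIp] at e1
  rw [← mul_assoc, ← sq, mul_one, ← mul_assoc, ← sq, ← sq_abs t, ht, mink_incenterVec hX hY hZ,
    det3_lift_sq_gromov hX hY hZ, ← gromov_add X Y Z, ← gromov_add Y Z X, ← gromov_add Z X Y,
    sum_sinh_sq] at e1
  have h1 := gromov_pos h
  have h2 : 0 < gromov Y Z X + gromov Z X Y := by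
    rw [gromov_add]
    exact hDist_pos hY hZ (ne_of_det3_ne_zero (by rwa [det3_rotate]))
  have k0 : 0 < Real.sinh (gromov X Y Z + gromov Y Z X + gromov Z X Y) :=
    Real.sinh_pos_iff.mpr (by linarith)
  -- After cancelling the common factor, the expansion of `sinh (x + y + z)` loses its `sinh sinh
  -- sinh` term to the subtracted product, leaving the three mixed terms.
  refine mul_left_cancel₀ (mul_pos four_pos k0).ne' ?_
  rw [e1, Real.sinh_add (gromov X Y Z + gromov Y Z X), Real.sinh_add, Real.cosh_add]
  ring

theorem sinh_half_log_three_sq : Real.sinh (1 / 2 * Real.log 3) ^ 2 = 1 / 3 := by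
  have h1 := Real.cosh_two_mul (1 / 2 * Real.log 3)
  rw [show 2 * (1 / 2 * Real.log 3) = Real.log 3 by ring, Real.cosh_log three_pos,
    Real.cosh_sq] at h1
  linarith

theorem half_log_three_pos : 0 < 1 / 2 * Real.log 3 := by
  have := Real.log_pos (show (1 : ℝ) < 3 by norm_num)
  positivity

theorem lt_of_sinh_sq_lt {r s : ℝ} (hs : 0 ≤ s) (h : Real.sinh r ^ 2 < Real.sinh s ^ 2) :
    r < s :=
  Real.sinh_lt_sinh.mp (lt_of_pow_lt_pow_left₀ 2 (Real.sinh_nonneg_iff.mpr hs) h)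

/-- As `sinh < cosh`, each of the three mixed terms exceeds the product of the `sinh`s, so `3 sinh²
r < 1`. -/
theorem inradius_lt {X Y Z I : ℂ} {r : ℝ} (h : IsHTriangle X Y Z) (hI : IsHIncircle X Y Z I r) :
    r < 1 / 2 * Real.log 3 := by
  obtain ⟨hX, hY, hZ, hD⟩ := isHTriangle_iff.mp h
  have hT1 : IsHTriangle Y Z X := isHTriangle_iff.mpr ⟨hY, hZ, hX, by rwa [det3_rotate]⟩
  have hT2 : IsHTriangle Z X Y := isHTriangle_iff.mpr ⟨hZ, hX, hY, by rwa [det3_rotate, det3_rotate]⟩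
  have e := sinh_inradius_sq h hI
  have k1 := Real.sinh_pos_iff.mpr (gromov_pos h)
  have k2 := Real.sinh_pos_iff.mpr (gromov_pos hT1)
  have k3 := Real.sinh_pos_iff.mpr (gromov_pos hT2)
  have c1 := Real.sinh_lt_cosh (gromov X Y Z)
  have c2 := Real.sinh_lt_cosh (gromov Y Z X)
  have c3 := Real.sinh_lt_cosh (gromov Z X Y)
  refine lt_of_sinh_sq_lt half_log_three_pos.le ?_
  rw [sinh_half_log_three_sq]
  generalize Real.sinh (gromov X Y Z) = x at *
  generalize Real.sinh (gromov Y Z X) = y at *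
  generalize Real.sinh (gromov Z X Y) = z at *
  generalize Real.cosh (gromov X Y Z) = x' at *
  generalize Real.cosh (gromov Y Z X) = y' at *
  generalize Real.cosh (gromov Z X Y) = z' at *
  have e1 : x * y * z < x * y' * z' := by
    rw [mul_assoc, mul_assoc]; gcongr
  have e2 : x * y * z < x' * y * z' := by
    calc x * y * z = y * (x * z) := by ring
      _ < y * (x' * z') := by gcongr
      _ = _ := by ring
  have e3 : x * y * z < x' * y' * z := by gcongr
  have hp : 0 < x * y * z := by positivity
  by_contra hc
  have hc' := not_lt.mp hc
  have := mul_le_mul_of_nonneg_right hc' (show 0 ≤ x * y' * z' + x' * y * z' + x' * y' * z by linarith)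
  linarith

/-! ### The limit at ideal vertices -/

/-- Converse estimate: if each `tanh` exceeds `√(3k)`, each product of two `coth`s is below
`1/(3k)`, and their sum, which is `1 / sinh² r`, is below `1/k`. -/
theorem lt_sinh_inradius_sq {X Y Z I : ℂ} {r k : ℝ} (hk : 0 < k) (h : IsHTriangle X Y Z)
    (hI : IsHIncircle X Y Z I r)
    (h1 : √(3 * k) * Real.cosh (gromov X Y Z) < Real.sinh (gromov X Y Z))
    (h2 : √(3 * k) * Real.cosh (gromov Y Z X) < Real.sinh (gromov Y Z X))
    (h3 : √(3 * k) * Real.cosh (gromov Z X Y) < Real.sinh (gromov Z X Y)) :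
    k < Real.sinh r ^ 2 := by
  have e := sinh_inradius_sq h hI
  have c1 := Real.cosh_pos (gromov X Y Z)
  have c2 := Real.cosh_pos (gromov Y Z X)
  have c3 := Real.cosh_pos (gromov Z X Y)
  have hm : 0 < √(3 * k) := by positivity
  have hm2 : √(3 * k) ^ 2 = 3 * k := Real.sq_sqrt (by positivity)
  generalize Real.sinh (gromov X Y Z) = x at *
  generalize Real.sinh (gromov Y Z X) = y at *
  generalize Real.sinh (gromov Z X Y) = z at *
  generalize Real.cosh (gromov X Y Z) = x' at *
  generalize Real.cosh (gromov Y Z X) = y' at *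
  generalize Real.cosh (gromov Z X Y) = z' at *
  generalize √(3 * k) = m at *
  have hx : 0 < x := lt_trans (by positivity) h1
  have hy : 0 < y := lt_trans (by positivity) h2
  have hz : 0 < z := lt_trans (by positivity) h3
  have e1 : x * ((m * y') * (m * z')) < x * (y * z) := by gcongr
  have e2 : y * ((m * x') * (m * z')) < y * (x * z) := by gcongr
  have e3 : z * ((m * x') * (m * y')) < z * (x * y) := by gcongr
  by_contra hc
  have := mul_le_mul_of_nonneg_right (not_lt.mp hc)
    (show 0 ≤ x * y' * z' + x' * y * z' + x' * y' * z by positivity)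
  have e4 : m ^ 2 * (x * y' * z' + x' * y * z' + x' * y' * z) < 3 * (x * y * z) := by linarith
  rw [hm2] at e4
  linarith

theorem eventually_mul_cosh_lt_sinh {m : ℝ} (hm0 : 0 < m) (hm : m < 1) :
    ∀ᶠ x : ℝ in atTop, m * Real.cosh x < Real.sinh x := by
  have h : Tendsto (fun x : ℝ => Real.exp (-x)) atTop (𝓝 0) := Real.tendsto_exp_neg_atTop_nhds_zero
  filter_upwards [h.eventually_lt_const (show 0 < 1 - m by linarith), eventually_ge_atTop 1]
    with x hx h1
  have h2 := Real.self_le_sinh_iff.mpr (zero_le_one.trans h1)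
  have h3 := Real.cosh_sub_sinh x
  nlinarith

theorem cosh_le_exp {x : ℝ} (hx : 0 ≤ x) : Real.cosh x ≤ Real.exp x := by
  have := Real.cosh_add_sinh x
  have := Real.sinh_nonneg_iff.mpr hx
  linarith

theorem exp_le_two_mul_cosh (x : ℝ) : Real.exp x ≤ 2 * Real.cosh x := by
  rw [Real.cosh_eq]
  have := Real.exp_pos (-x)
  linarith

/-- The exponential of twice the Gromov product is `e^b e^c / e^a`. Bound the numerator below by
`cosh`s with their summand 1 dropped, and the denominator above by `2 cosh`. No exact distance is
needed, only growth. -/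
theorem le_exp_gromov {X Y Z : ℂ} (hX : X ∈ hPlane) (hY : Y ∈ hPlane) (hZ : Z ∈ hPlane) :
    2 * dist Z X ^ 2 * dist X Y ^ 2 * ((1 - ‖X‖ ^ 2) ^ 2 *
      ((1 - ‖Y‖ ^ 2) * (1 - ‖Z‖ ^ 2) + 2 * dist Y Z ^ 2))⁻¹ ≤ Real.exp (2 * gromov X Y Z) := by
  have pX : 0 < 1 - ‖X‖ ^ 2 := by rw [norm_sq_eq]; exact mem_hPlane_iff.mp hX
  have pY : 0 < 1 - ‖Y‖ ^ 2 := by rw [norm_sq_eq]; exact mem_hPlane_iff.mp hY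
  have pZ : 0 < 1 - ‖Z‖ ^ 2 := by rw [norm_sq_eq]; exact mem_hPlane_iff.mp hZ
  have b := cosh_le_exp (hDist_nonneg hZ hX)
  have c := cosh_le_exp (hDist_nonneg hX hY)
  have a := exp_le_two_mul_cosh (hDist Y Z)
  rw [(cosh_hDist hZ hX).2] at b
  rw [(cosh_hDist hX hY).2] at c
  rw [(cosh_hDist hY hZ).2] at a
  rw [gromov, mul_div_cancel₀ _ two_ne_zero, Real.exp_sub, Real.exp_add]
  calc _ = (2 * dist X Y ^ 2 / ((1 - ‖X‖ ^ 2) * (1 - ‖Y‖ ^ 2))) *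
        (2 * dist Z X ^ 2 / ((1 - ‖Z‖ ^ 2) * (1 - ‖X‖ ^ 2))) /
        (2 * (1 + 2 * dist Y Z ^ 2 / ((1 - ‖Y‖ ^ 2) * (1 - ‖Z‖ ^ 2)))) := by field_simp
    _ ≤ _ := by
      gcongr
      · linarith
      · linarith

/-- In the lower bound of `le_exp_gromov` the factor `(1 - ‖X‖²)²` tends to 0 while the distances
from `X` to the other two vertices stay away from 0. -/
theorem tendsto_gromov {ι : Type*} {f : Filter ι} {X Y Z : ι → ℂ} {A B C : ℂ}
    (hX : Tendsto X f (𝓝 A)) (hY : Tendsto Y f (𝓝 B)) (hZ : Tendsto Z f (𝓝 C))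
    (hX' : ∀ᶠ i in f, X i ∈ hPlane) (hY' : ∀ᶠ i in f, Y i ∈ hPlane)
    (hZ' : ∀ᶠ i in f, Z i ∈ hPlane) (hA : A ∈ absolute) (hAB : A ≠ B) (hCA : C ≠ A) :
    Tendsto (fun i => gromov (X i) (Y i) (Z i)) f atTop := by
  set G : ι → ℝ := fun i => 2 * dist (Z i) (X i) ^ 2 * dist (X i) (Y i) ^ 2 * ((1 - ‖X i‖ ^ 2) ^ 2 *
      ((1 - ‖Y i‖ ^ 2) * (1 - ‖Z i‖ ^ 2) + 2 * dist (Y i) (Z i) ^ 2))⁻¹ with hG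
  have hGt : Tendsto G f atTop := by
    have hnum : Tendsto (fun i => 2 * dist (Z i) (X i) ^ 2 * dist (X i) (Y i) ^ 2) f
        (𝓝 (2 * dist C A ^ 2 * dist A B ^ 2)) :=
      (((hZ.dist hX).pow 2).const_mul 2).mul ((hX.dist hY).pow 2)
    have hden : Tendsto (fun i => (1 - ‖X i‖ ^ 2) ^ 2 *
        ((1 - ‖Y i‖ ^ 2) * (1 - ‖Z i‖ ^ 2) + 2 * dist (Y i) (Z i) ^ 2)) f (𝓝[>] 0) := by
      rw [tendsto_nhdsWithin_iff]
      constructor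
      · have h0 : ‖A‖ = 1 := by simpa [absolute] using hA
        have : Tendsto (fun i => (1 - ‖X i‖ ^ 2) ^ 2 *
            ((1 - ‖Y i‖ ^ 2) * (1 - ‖Z i‖ ^ 2) + 2 * dist (Y i) (Z i) ^ 2)) f
            (𝓝 ((1 - ‖A‖ ^ 2) ^ 2 *
            ((1 - ‖B‖ ^ 2) * (1 - ‖C‖ ^ 2) + 2 * dist B C ^ 2))) :=
          (((hX.norm.pow 2).const_sub 1).pow 2).mul
            ((((hY.norm.pow 2).const_sub 1).mul ((hZ.norm.pow 2).const_sub 1)).add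
              (((hY.dist hZ).pow 2).const_mul 2))
        rwa [h0, show ((1 : ℝ) - 1 ^ 2) ^ 2 = 0 by norm_num, zero_mul] at this
      · filter_upwards [hX', hY', hZ'] with i h1 h2 h3
        have pX : 0 < 1 - ‖X i‖ ^ 2 := by rw [norm_sq_eq]; exact mem_hPlane_iff.mp h1
        have pY : 0 < 1 - ‖Y i‖ ^ 2 := by rw [norm_sq_eq]; exact mem_hPlane_iff.mp h2
        have pZ : 0 < 1 - ‖Z i‖ ^ 2 := by rw [norm_sq_eq]; exact mem_hPlane_iff.mp h3
        rw [Set.mem_Ioi]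
        positivity
    have h1 := dist_pos.mpr hAB
    have h2 := dist_pos.mpr hCA
    exact hnum.pos_mul_atTop (by positivity) hden.inv_tendsto_nhdsGT_zero
  refine tendsto_atTop_mono' f ?_ ((Real.tendsto_log_atTop.comp hGt).atTop_div_const two_pos)
  filter_upwards [hX', hY', hZ', hGt.eventually_gt_atTop 0] with i h1 h2 h3 h4
  have := (Real.log_le_iff_le_exp h4).mpr (le_exp_gromov h1 h2 h3)
  simp only [Function.comp_apply]
  linarith

theorem eventually_isHTriangle {A B C : ℂ} (hA : A ∈ absolute) (hB : B ∈ absolute)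
    (hC : C ∈ absolute) (hAB : A ≠ B) (hBC : B ≠ C) (hCA : C ≠ A) {ε : ℝ} (hε : 0 < ε) :
    ∀ᶠ T in 𝓝[hPlane ×ˢ hPlane ×ˢ hPlane] (A, B, C),
      IsHTriangle T.1 T.2.1 T.2.2 ∧
      ∀ (I : ℂ) (r : ℝ), IsHIncircle T.1 T.2.1 T.2.2 I r → 1 / 2 * Real.log 3 - ε < r := by
  set f := 𝓝[hPlane ×ˢ hPlane ×ˢ hPlane] (A, B, C)
  have hid : Tendsto id f (𝓝 (A, B, C)) := tendsto_id'.mpr nhdsWithin_le_nhds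
  have hX : Tendsto (fun T : ℂ × ℂ × ℂ => T.1) f (𝓝 A) := (continuous_fst.tendsto _).comp hid
  have hY : Tendsto (fun T : ℂ × ℂ × ℂ => T.2.1) f (𝓝 B) :=
    ((continuous_fst.comp continuous_snd).tendsto _).comp hid
  have hZ : Tendsto (fun T : ℂ × ℂ × ℂ => T.2.2) f (𝓝 C) :=
    ((continuous_snd.comp continuous_snd).tendsto _).comp hid
  have hmem : ∀ᶠ T in f, T ∈ hPlane ×ˢ hPlane ×ˢ hPlane := self_mem_nhdsWithin
  have hX' : ∀ᶠ T in f, T.1 ∈ hPlane := hmem.mono fun T h => h.1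
  have hY' : ∀ᶠ T in f, T.2.1 ∈ hPlane := hmem.mono fun T h => h.2.1
  have hZ' : ∀ᶠ T in f, T.2.2 ∈ hPlane := hmem.mono fun T h => h.2.2
  have g1 := tendsto_gromov hX hY hZ hX' hY' hZ' hA hAB hCA
  have g2 := tendsto_gromov hY hZ hX hY' hZ' hX' hB hBC hAB
  have g3 := tendsto_gromov hZ hX hY hZ' hX' hY' hC hCA hBC
  have hT : ∀ᶠ T in f, IsHTriangle T.1 T.2.1 T.2.2 := by
    filter_upwards [hX', hY', hZ', g1.eventually_gt_atTop 0, g2.eventually_gt_atTop 0,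
      g3.eventually_gt_atTop 0] with T h1 h2 h3 h4 h5 h6
    exact isHTriangle_of_gromov_pos h1 h2 h3 h4 h5 h6
  refine hT.and ?_
  -- If the claimed lower bound is not positive, positivity of the radius suffices.
  rcases le_or_gt (1 / 2 * Real.log 3 - ε) 0 with h0 | h0
  · exact Eventually.of_forall fun T I r h => h0.trans_lt h.2.1
  · have s0 := Real.sinh_pos_iff.mpr h0
    have s1 : Real.sinh (1 / 2 * Real.log 3 - ε) ^ 2 < 1 / 3 := by
      rw [← sinh_half_log_three_sq]
      exact pow_lt_pow_left₀ (Real.sinh_lt_sinh.mpr (by linarith)) s0.le two_ne_zero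
    -- Here `k = sinh² (½ ln 3 - ε) < 1/3`, so `√(3k) < 1` and large tangent lengths satisfy the
    -- required inequality.
    have hm := eventually_mul_cosh_lt_sinh (m := √(3 * Real.sinh (1 / 2 * Real.log 3 - ε) ^ 2))
      (by positivity) ((Real.sqrt_lt' one_pos).mpr (by linarith))
    filter_upwards [hT, g1.eventually hm, g2.eventually hm, g3.eventually hm]
      with T h h1 h2 h3 I r hI
    exact lt_of_sinh_sq_lt hI.2.1.le (lt_sinh_inradius_sq (by positivity) h hI h1 h2 h3)

/-! ### The incircle of an ideal triangle -/

/-- The weighted sum of the ideal vertices of an ideal triangle over its incentre. -/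
noncomputable def idealVec (A B C : ℂ) : ℝ × ℝ × ℝ :=
  mink (hom B) (hom C) • hom A + mink (hom C) (hom A) • hom B + mink (hom A) (hom B) • hom C

theorem mink_hom_self {A : ℂ} (hA : A ∈ absolute) : mink (hom A) (hom A) = 0 := by
  rw [mink_hom, mem_absolute_iff.mp hA, dist_self]; norm_num

theorem mink_hom_pos {A B : ℂ} (hA : A ∈ absolute) (hAB : A ≠ B) :
    0 < mink (hom A) (hom B) := by
  have := dist_pos.mpr hAB
  rw [mink_hom, mem_absolute_iff.mp hA, zero_mul, zero_add]
  positivity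

theorem isTangentToLine_hLine_iff {A B I : ℂ} {r : ℝ} (hA : A ∈ absolute) (hB : B ∈ absolute)
    (hAB : A ≠ B) (hI : I ∈ hPlane) (hr : 0 < r) :
    IsTangentToLine I r (hLine A B) ↔
      Real.sinh r * mink (hom A) (hom B) = |det3 (hom A) (hom B) (lift I)| := by
  have hp := mink_hom_pos hA hAB
  have hn : mink (cross (hom A) (hom B)) (cross (hom A) (hom B)) = -mink (hom A) (hom B) ^ 2 := by
    rw [mink_cross_cross, mink_hom_self hA, mink_hom_self hB]; ring
  rw [hLine_eq (by rw [hn]; simpa using pow_pos hp 2), isTangentToLine_iff hp hn hI hr, det3]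

theorem det3_hom_sq {A B C : ℂ} (hA : A ∈ absolute) (hB : B ∈ absolute) (hC : C ∈ absolute) :
    det3 (hom A) (hom B) (hom C) ^ 2 =
      2 * (mink (hom A) (hom B) * mink (hom B) (hom C) * mink (hom C) (hom A)) := by
  rw [det3_sq, mink_hom_self hA, mink_hom_self hB, mink_hom_self hC]; ring

/-- Same Cramer argument as for h-triangles, with null vectors. The sides are whole h-lines, so no
condition on the position of the contact points is available; mixed signs are excluded because `I`
is time-like. -/
theorem isIdealIncircle_iff {A B C I : ℂ} {r : ℝ} (hA : A ∈ absolute) (hB : B ∈ absolute)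
    (hC : C ∈ absolute) (hAB : A ≠ B) (hBC : B ≠ C) (hCA : C ≠ A) :
    IsIdealIncircle A B C I r ↔ I ∈ hPlane ∧ 0 < r ∧ ∃ t, |t| = Real.sinh r ∧
      det3 (hom A) (hom B) (hom C) • lift I = t • idealVec A B C := by
  refine and_congr_right fun hI => and_congr_right fun hr => ?_
  have hs : 0 < Real.sinh r := Real.sinh_pos_iff.mpr hr
  rw [isTangentToLine_hLine_iff hA hB hAB hI hr, isTangentToLine_hLine_iff hB hC hBC hI hr,
    isTangentToLine_hLine_iff hC hA hCA hI hr, idealVec]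
  have hD2 := det3_hom_sq hA hB hC
  have cr := det3_smul_eq (hom A) (hom B) (hom C) (lift I)
  have hp := mink_hom_pos hB hBC
  have hq := mink_hom_pos hC hCA
  have hr := mink_hom_pos hA hAB
  have hII := mink_lift_self hI
  have sA := mink_hom_self hA
  have sB := mink_hom_self hB
  have sC := mink_hom_self hC
  set D := det3 (hom A) (hom B) (hom C) with hDdef
  set p := mink (hom B) (hom C) with hpdef
  set q := mink (hom C) (hom A) with hqdef
  set w := mink (hom A) (hom B) with hwdef
  set s := Real.sinh r
  have hpq : 0 < w * p * q := by positivity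
  have hD : D ≠ 0 := by
    intro h0
    rw [h0] at hD2
    linarith
  constructor
  · rintro ⟨t3, t1, t2⟩
    -- The vertices are null, so the square of the Cramer expansion has cross terms only, and `⟨I,
    -- I⟩ = 1` makes their signed sum positive. For mixed signs that sum is `-1`.
    have nrm : ∀ e1 e2 e3 : ℝ, det3 (hom B) (hom C) (lift I) = e1 * (s * p) →
        det3 (hom C) (hom A) (lift I) = e2 * (s * q) →
        det3 (hom A) (hom B) (lift I) = e3 * (s * w) →
        0 < e1 * e2 + e2 * e3 + e3 * e1 := by
      intro e1 e2 e3 h1 h2 h3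
      rw [h1, h2, h3] at cr
      have e := congrArg (fun v => mink v v) cr
      simp only [mink_add_left, mink_add_right, mink_smul_left, mink_smul_right, hII, sA, sB, sC,
        mink_comm (hom B) (hom A), mink_comm (hom C) (hom B), mink_comm (hom A) (hom C),
        ← hpdef, ← hqdef, ← hwdef] at e
      have e' : (s ^ 2 * (w * p * q)) * (e1 * e2 + e2 * e3 + e3 * e1) = w * p * q := by
        linear_combination (-1 / 2) * e + hD2 / 2
      exact pos_of_mul_pos_right (e' ▸ hpq) (by positivity)
    have fin : ∀ e : ℝ, |e| = 1 → det3 (hom B) (hom C) (lift I) = e * (s * p) →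
        det3 (hom C) (hom A) (lift I) = e * (s * q) →
        det3 (hom A) (hom B) (lift I) = e * (s * w) → ∃ t, |t| = s ∧
          D • lift I = t • (p • hom A + q • hom B + w • hom C) := by
      intro e he h1 h2 h3
      refine ⟨e * s, by rw [abs_mul, he, one_mul, abs_of_pos hs], ?_⟩
      rw [cr, h1, h2, h3]
      simp only [smul_add, smul_smul, mul_assoc]
    have sgn : ∀ d x : ℝ, 0 < x → s * x = |d| → d = 1 * (s * x) ∨ d = (-1) * (s * x) := by
      intro d x hx h
      rcases abs_eq (mul_pos hs hx).le |>.mp h.symm with h | h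
      · left; rw [h, one_mul]
      · right; rw [h]; ring
    rcases sgn _ _ hp t1 with h1 | h1 <;> rcases sgn _ _ hq t2 with h2 | h2 <;>
      rcases sgn _ _ hr t3 with h3 | h3
    · exact fin 1 (by simp) h1 h2 h3
    · exact absurd (nrm _ _ _ h1 h2 h3) (by norm_num)
    · exact absurd (nrm _ _ _ h1 h2 h3) (by norm_num)
    · exact absurd (nrm _ _ _ h1 h2 h3) (by norm_num)
    · exact absurd (nrm _ _ _ h1 h2 h3) (by norm_num)
    · exact absurd (nrm _ _ _ h1 h2 h3) (by norm_num)
    · exact absurd (nrm _ _ _ h1 h2 h3) (by norm_num)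
    · exact fin (-1) (by simp) h1 h2 h3
  · rintro ⟨t, ht, e⟩
    rw [smul_add, smul_add, smul_smul, smul_smul, smul_smul] at e
    have d1 : det3 (hom B) (hom C) (lift I) = t * p := by
      have := congrArg (fun v => det3 (hom B) (hom C) v) e
      simp only [det3, mink_add_left, mink_smul_left, mink_cross_left, mink_cross_right] at this
      have h1 : mink (hom A) (cross (hom B) (hom C)) = D := det3_rotate _ _ _
      rw [h1] at this
      exact mul_left_cancel₀ hD (by simp only [det3]; linarith)
    have d2 : det3 (hom C) (hom A) (lift I) = t * q := by
      have := congrArg (fun v => det3 (hom C) (hom A) v) e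
      simp only [det3, mink_add_left, mink_smul_left, mink_cross_left, mink_cross_right] at this
      have h1 : mink (hom B) (cross (hom C) (hom A)) = D := (det3_rotate _ _ _).symm
      rw [h1] at this
      exact mul_left_cancel₀ hD (by simp only [det3]; linarith)
    have d3 : det3 (hom A) (hom B) (lift I) = t * w := by
      have := congrArg (fun v => det3 (hom A) (hom B) v) e
      simp only [det3, mink_add_left, mink_smul_left, mink_cross_left, mink_cross_right] at this
      have h1 : mink (hom C) (cross (hom A) (hom B)) = D := rfl
      rw [h1] at this
      exact mul_left_cancel₀ hD (by simp only [det3]; linarith)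
    exact ⟨by rw [d3, abs_mul, ht, abs_of_pos hr], by rw [d1, abs_mul, ht, abs_of_pos hp],
      by rw [d2, abs_mul, ht, abs_of_pos hq]⟩

/-- Each of the three pairs of vertices contributes twice the product of all three mutual products,
which is `D²`. Hence the radius does not depend on the triangle. -/
theorem mink_idealVec {A B C : ℂ} (hA : A ∈ absolute) (hB : B ∈ absolute) (hC : C ∈ absolute) :
    mink (idealVec A B C) (idealVec A B C) = 3 * det3 (hom A) (hom B) (hom C) ^ 2 := by
  rw [det3_hom_sq hA hB hC]
  simp only [idealVec, mink_add_left, mink_add_right, mink_smul_left, mink_smul_right,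
    mink_hom_self hA, mink_hom_self hB, mink_hom_self hC,
    mink_comm (hom B) (hom A), mink_comm (hom C) (hom B), mink_comm (hom A) (hom C)]
  ring

theorem det3_hom_ne_zero {A B C : ℂ} (hA : A ∈ absolute) (hB : B ∈ absolute) (hC : C ∈ absolute)
    (hAB : A ≠ B) (hBC : B ≠ C) (hCA : C ≠ A) : det3 (hom A) (hom B) (hom C) ≠ 0 := by
  have h := det3_hom_sq hA hB hC
  have := mink_hom_pos hB hBC
  have := mink_hom_pos hC hCA
  have := mink_hom_pos hA hAB
  intro h0
  have hpos : 0 < mink (hom A) (hom B) * mink (hom B) (hom C) * mink (hom C) (hom A) := by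
    positivity
  rw [h0] at h
  linarith

theorem existsUnique_isIdealIncircle {A B C : ℂ} (hA : A ∈ absolute) (hB : B ∈ absolute)
    (hC : C ∈ absolute) (hAB : A ≠ B) (hBC : B ≠ C) (hCA : C ≠ A) :
    ∃! p : ℂ × ℝ, IsIdealIncircle A B C p.1 p.2 := by
  have hD := det3_hom_ne_zero hA hB hC hAB hBC hCA
  simp only [isIdealIncircle_iff hA hB hC hAB hBC hCA]
  obtain ⟨I, hI, r, hr, t, ht, e⟩ := exists_smul_lift_eq (S := idealVec A B C)
    (by rw [mink_idealVec hA hB hC]; positivity) hD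
  refine ⟨(I, r), ⟨hI, hr, t, ht, e⟩, ?_⟩
  rintro ⟨J, s⟩ ⟨hJ, -, u, hu, e'⟩
  obtain ⟨h1, h2⟩ := eq_of_smul_lift_eq hJ hI hD hu ht e' e
  exact Prod.ext h1 h2

theorem idealIncircle_radius {A B C I : ℂ} {r : ℝ} (hA : A ∈ absolute) (hB : B ∈ absolute)
    (hC : C ∈ absolute) (hAB : A ≠ B) (hBC : B ≠ C) (hCA : C ≠ A)
    (h : IsIdealIncircle A B C I r) : r = 1 / 2 * Real.log 3 := by
  obtain ⟨hI, hr, t, ht, e⟩ := (isIdealIncircle_iff hA hB hC hAB hBC hCA).mp h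
  have hD := det3_hom_ne_zero hA hB hC hAB hBC hCA
  have e1 := congrArg (fun v => mink v v) e
  simp only [mink_smul_left, mink_smul_right, mink_lift_self hI, mink_idealVec hA hB hC] at e1
  have e2 : t ^ 2 = 1 / 3 := by
    refine mul_left_cancel₀ (pow_ne_zero 2 hD) ?_
    linear_combination (-1 / 3) * e1
  rw [← sq_abs, ht, ← sinh_half_log_three_sq] at e2
  exact Real.sinh_injective ((sq_eq_sq₀ (Real.sinh_nonneg_iff.mpr hr.le)
    (Real.sinh_nonneg_iff.mpr half_log_three_pos.le)).mp e2)

/-! ### Tangent directions and the law of cosines -/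

/-- The differential at `Q` of the Möbius transformation centred at `Q`, as a linear map on the
hyperboloid model. -/
noncomputable def dirMap (Q : ℂ) (v : ℝ × ℝ × ℝ) : ℂ :=
  -Q * (v.1 : ℂ) + ((⟨v.2.1, v.2.2⟩ : ℂ) + Q ^ 2 * ⟨v.2.1, -v.2.2⟩) / 2

theorem dirMap_add_smul (Q : ℂ) (a b : ℝ) (u v : ℝ × ℝ × ℝ) :
    dirMap Q (a • u + b • v) = (a : ℂ) * dirMap Q u + b * dirMap Q v := by
  simp only [dirMap, Prod.smul_fst, Prod.smul_snd, smul_eq_mul, Prod.fst_add, Prod.snd_add,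
    Complex.mk_eq_add_mul_I]
  push_cast
  ring

theorem dirMap_hom (Q W : ℂ) : dirMap Q (hom W) = (W - Q) * (1 - Q * conj W) := by
  apply Complex.ext <;> simp [dirMap, hom, pow_two] <;> ring

theorem dirMap_lift (Q W : ℂ) : dirMap Q (lift W) =
    (((1 - (W.re ^ 2 + W.im ^ 2))⁻¹ : ℝ) : ℂ) * ((W - Q) * (1 - Q * conj W)) := by
  rw [← dirMap_hom, lift]
  have := dirMap_add_smul Q (1 - (W.re ^ 2 + W.im ^ 2))⁻¹ 0 (hom W) 0
  simpa using this

theorem one_sub_mul_conj_ne_zero {Q W : ℂ} (hQ : Q ∈ hPlane) (hW : W ∈ hPlane) :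
    1 - Q * conj W ≠ 0 := by
  intro h
  have h1 : ‖Q * conj W‖ = 1 := by rw [← sub_eq_zero.mp h, norm_one]
  rw [norm_mul, Complex.norm_conj] at h1
  have hQ' : ‖Q‖ < 1 := by simpa [hPlane] using hQ
  have hW' : ‖W‖ < 1 := by simpa [hPlane] using hW
  have := mul_lt_one_of_nonneg_of_lt_one_left (norm_nonneg Q) hQ' hW'.le
  linarith

theorem dirMap_lift_ne_zero {Q P : ℂ} (hQ : Q ∈ hPlane) (hP : P ∈ hPlane) (h : P ≠ Q) :
    dirMap Q (lift P) ≠ 0 := by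
  have := mem_hPlane_iff.mp hP
  rw [dirMap_lift]
  exact mul_ne_zero (Complex.ofReal_ne_zero.mpr (by positivity))
    (mul_ne_zero (sub_ne_zero.mpr h) (one_sub_mul_conj_ne_zero hQ hP))

/-- Up to a conformal factor, the Euclidean inner product of directions is minus the Minkowski
product of the components orthogonal to `lift Q`. -/
theorem inner_dirMap {Q : ℂ} (hQ : Q ∈ hPlane) (u v : ℝ × ℝ × ℝ) :
    inner ℝ (dirMap Q u) (dirMap Q v) = ((1 - (Q.re ^ 2 + Q.im ^ 2)) / 2) ^ 2 *
      (mink (lift Q) u * mink (lift Q) v - mink u v) := by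
  have h := mem_hPlane_iff.mp hQ
  have e : 4 * inner ℝ (dirMap Q u) (dirMap Q v) =
      mink (hom Q) u * mink (hom Q) v - (1 - (Q.re ^ 2 + Q.im ^ 2)) ^ 2 * mink u v := by
    rw [Complex.inner, Complex.mul_re, Complex.conj_re, Complex.conj_im]
    simp [dirMap, mink, hom, pow_two]
    ring
  rw [lift, mink_smul_left, mink_smul_left]
  field_simp
  linarith

theorem norm_dirMap {Q P : ℂ} (hQ : Q ∈ hPlane) (hP : P ∈ hPlane) :
    ‖dirMap Q (lift P)‖ = (1 - (Q.re ^ 2 + Q.im ^ 2)) / 2 * Real.sinh (hDist Q P) := by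
  have h := mem_hPlane_iff.mp hQ
  rw [← sq_eq_sq₀ (norm_nonneg _)
    (mul_nonneg (by positivity) (Real.sinh_nonneg_iff.mpr (hDist_nonneg hQ hP))),
    ← real_inner_self_eq_norm_sq, inner_dirMap hQ, mul_pow, sinh_hDist_sq hQ hP, mink_lift_self hP,
    ← sq]

theorem drop_lift {Q : ℂ} (hQ : Q ∈ hPlane) : drop (lift Q) = Q :=
  lift_injOn (drop_mem (mink_lift_self hQ) (lift_fst_pos hQ)) hQ
    (lift_drop (mink_lift_self hQ) (lift_fst_pos hQ))

theorem continuousAt_drop {v : ℝ × ℝ × ℝ} (h : 0 < v.1) : ContinuousAt drop v := by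
  have e : drop = fun v : ℝ × ℝ × ℝ =>
      ((v.2.1 / (1 + v.1) : ℝ) : ℂ) + ((v.2.2 / (1 + v.1) : ℝ) : ℂ) * Complex.I := by
    funext v
    rw [drop, Complex.mk_eq_add_mul_I]
  have h0 : 1 + v.1 ≠ 0 := by positivity
  rw [e]
  fun_prop (disch := assumption)

theorem dirMap_self (Q : ℂ) : dirMap Q (lift Q) = 0 := by
  rw [dirMap_lift, sub_self, zero_mul, mul_zero]

/-- Makes the filter in `tangentDir` nontrivial, so that its `limUnder` is determined by
convergence. The approach is along the normalised vectors `lift Q + s • lift P` as `s` decreases to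
0. -/
theorem mem_closure_hSegment {Q P : ℂ} (hQ : Q ∈ hPlane) (hP : P ∈ hPlane) (h : P ≠ Q) :
    Q ∈ closure (hSegment Q P \ {Q}) := by
  set N : ℝ → ℝ := fun s => √(1 + 2 * s * mink (lift Q) (lift P) + s ^ 2) with hN
  have hC := one_le_mink hQ hP
  have ht : Tendsto (fun s : ℝ => drop ((N s)⁻¹ • (lift Q + s • lift P))) (𝓝[>] 0) (𝓝 Q) := by
    have h1 : N 0 = 1 := by simp [hN]
    have h2 : ContinuousAt (fun s : ℝ => drop ((N s)⁻¹ • (lift Q + s • lift P))) 0 := by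
      refine ContinuousAt.comp (g := drop) ?_ ?_
      · apply continuousAt_drop
        simp [h1, lift_fst_pos hQ]
      · have h3 : ContinuousAt N 0 := by fun_prop
        have h4 : N 0 ≠ 0 := by rw [h1]; exact one_ne_zero
        fun_prop (disch := assumption)
    have h5 := h2.tendsto
    simp only [h1, inv_one, one_smul, zero_smul, add_zero, drop_lift hQ] at h5
    exact h5.mono_left nhdsWithin_le_nhds
  refine mem_closure_of_tendsto ht (eventually_mem_nhdsWithin.mono fun s hs => ?_)
  have hs : 0 < s := hs
  have hpos : 0 < 1 + 2 * s * mink (lift Q) (lift P) + s ^ 2 := by positivity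
  have hNp : 0 < N s := Real.sqrt_pos.mpr hpos
  have hN2 : N s ^ 2 = 1 + 2 * s * mink (lift Q) (lift P) + s ^ 2 := Real.sq_sqrt hpos.le
  have hm : mink ((N s)⁻¹ • (lift Q + s • lift P)) ((N s)⁻¹ • (lift Q + s • lift P)) = 1 := by
    simp only [mink_smul_left, mink_smul_right, mink_add_left, mink_add_right, mink_lift_self hQ,
      mink_lift_self hP, mink_comm (lift P) (lift Q)]
    field_simp
    rw [hN2]
    ring
  have hf : 0 < ((N s)⁻¹ • (lift Q + s • lift P)).1 := by
    have := lift_fst_pos hQ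
    have := lift_fst_pos hP
    simp only [Prod.smul_fst, Prod.fst_add, smul_eq_mul]
    positivity
  have e := lift_drop hm hf
  have e' : lift (drop ((N s)⁻¹ • (lift Q + s • lift P))) =
      (N s)⁻¹ • lift Q + ((N s)⁻¹ * s) • lift P := by rw [e, smul_add, smul_smul]
  refine ⟨(mem_hSegment_iff hQ hP h.symm).mpr
    ⟨drop_mem hm hf, _, _, by positivity, by positivity, e'⟩, fun hW => ?_⟩
  rw [Set.mem_singleton_iff.mp hW] at e'
  have h1 := congrArg (dirMap Q) e'
  rw [dirMap_add_smul, dirMap_self, mul_zero, zero_add] at h1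
  rcases mul_eq_zero.mp h1.symm with h2 | h2
  · exact absurd (Complex.ofReal_eq_zero.mp h2) (by positivity)
  · exact dirMap_lift_ne_zero hQ hP h h2

/-- `dirMap Q` is linear and kills `lift Q`, so along the segment from `Q` to `P` it takes values in
a single half-line. It differs from `W - Q` by a positive scalar and the continuous factor `1 - Q *
conj W`, which is a positive real number at `W = Q`. -/
theorem tangentDir_eq {Q P : ℂ} (hQ : Q ∈ hPlane) (hP : P ∈ hPlane) (h : P ≠ Q) :
    tangentDir Q P = ‖dirMap Q (lift P)‖⁻¹ • dirMap Q (lift P) := by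
  have hne : (𝓝[hSegment Q P \ {Q}] Q).NeBot :=
    mem_closure_iff_nhdsWithin_neBot.mp (mem_closure_hSegment hQ hP h)
  set L := dirMap Q (lift P) with hL
  have hL0 : L ≠ 0 := dirMap_lift_ne_zero hQ hP h
  set g : ℂ → ℂ := fun W => L * (1 - Q * conj W)⁻¹ with hg
  have hQQ := one_sub_mul_conj_ne_zero hQ hQ
  have hg0 : g Q ≠ 0 := mul_ne_zero hL0 (inv_ne_zero hQQ)
  have hgc : ContinuousAt g Q := by
    have : Continuous fun W : ℂ => 1 - Q * conj W := by fun_prop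
    exact continuousAt_const.mul (this.continuousAt.inv₀ hQQ)
  have hgt : ContinuousAt (fun W => ‖g W‖⁻¹ • g W) Q :=
    (hgc.norm.inv₀ (norm_ne_zero_iff.mpr hg0)).smul hgc
  have scale : ∀ (c : ℝ) (w : ℂ), 0 < c → ‖(c : ℂ) * w‖⁻¹ • ((c : ℂ) * w) = ‖w‖⁻¹ • w := by
    intro c w hc
    rw [norm_mul, Complex.norm_real, Real.norm_of_nonneg hc.le, Complex.real_smul,
      Complex.real_smul]
    have : (c : ℂ) ≠ 0 := Complex.ofReal_ne_zero.mpr hc.ne'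
    push_cast
    rw [mul_inv]
    field_simp
  have hgQ : ‖g Q‖⁻¹ • g Q = ‖L‖⁻¹ • L := by
    have h1 := mem_hPlane_iff.mp hQ
    have h2 : g Q = (((1 - (Q.re ^ 2 + Q.im ^ 2))⁻¹ : ℝ) : ℂ) * L := by
      rw [hg]
      simp only
      rw [Complex.mul_conj, Complex.normSq_apply, mul_comm]
      push_cast
      ring
    rw [h2, scale _ _ (by positivity)]
  refine Tendsto.limUnder_eq (Tendsto.congr' ?_ (hgQ ▸ hgt.tendsto.mono_left nhdsWithin_le_nhds))
  filter_upwards [eventually_mem_nhdsWithin] with W hW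
  obtain ⟨hW1, α, β, hα, hβ, e⟩ := (mem_hSegment_iff hQ hP h.symm).mp hW.1
  have hWp := mem_hPlane_iff.mp hW1
  have hWQ : W ≠ Q := hW.2
  have h1 := congrArg (dirMap Q) e
  rw [dirMap_add_smul, dirMap_self, mul_zero, zero_add, ← hL] at h1
  have hβ' : 0 < β := lt_of_le_of_ne hβ (by
    rintro rfl
    rw [Complex.ofReal_zero, zero_mul] at h1
    exact dirMap_lift_ne_zero hQ hW1 hWQ h1)
  rw [dirMap_lift] at h1
  have h2 := one_sub_mul_conj_ne_zero hQ hW1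
  have h3 : W - Q = (((1 - (W.re ^ 2 + W.im ^ 2)) * β : ℝ) : ℂ) * g W := by
    have h4 : (((1 - (W.re ^ 2 + W.im ^ 2) : ℝ)) : ℂ) ≠ 0 := Complex.ofReal_ne_zero.mpr hWp.ne'
    rw [Complex.ofReal_inv] at h1
    rw [hg, Complex.ofReal_mul]
    simp only
    field_simp at h1 ⊢
    linear_combination h1
  rw [h3, scale _ _ (by positivity)]

/-- The law of cosines. -/
theorem cos_hAngle {P Q R : ℂ} (hP : P ∈ hPlane) (hQ : Q ∈ hPlane) (hR : R ∈ hPlane)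
    (hPQ : P ≠ Q) (hRQ : R ≠ Q) :
    Real.sinh (hDist Q P) * Real.sinh (hDist Q R) * Real.cos (hAngle P Q R) =
      mink (lift Q) (lift P) * mink (lift Q) (lift R) - mink (lift P) (lift R) := by
  have h := mem_hPlane_iff.mp hQ
  have hP0 := norm_pos_iff.mpr (dirMap_lift_ne_zero hQ hP hPQ)
  have hR0 := norm_pos_iff.mpr (dirMap_lift_ne_zero hQ hR hRQ)
  have e : hAngle P Q R =
      InnerProductGeometry.angle (dirMap Q (lift P)) (dirMap Q (lift R)) := by
    rw [hAngle, tangentDir_eq hQ hP hPQ, tangentDir_eq hQ hR hRQ,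
      InnerProductGeometry.angle_smul_left_of_pos _ _ (by positivity),
      InnerProductGeometry.angle_smul_right_of_pos _ _ (by positivity)]
  have hsP := Real.sinh_pos_iff.mpr (hDist_pos hQ hP hPQ.symm)
  have hsR := Real.sinh_pos_iff.mpr (hDist_pos hQ hR hRQ.symm)
  rw [e, InnerProductGeometry.cos_angle, inner_dirMap hQ, norm_dirMap hQ hP, norm_dirMap hQ hR]
  field_simp

theorem hAngle_mem (P Q R : ℂ) : hAngle P Q R ∈ Set.Icc 0 Real.pi :=
  ⟨InnerProductGeometry.angle_nonneg _ _, InnerProductGeometry.angle_le_pi _ _⟩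

theorem hAngle_eq_pi_div_two_iff {P Q R : ℂ} (hP : P ∈ hPlane) (hQ : Q ∈ hPlane) (hR : R ∈ hPlane)
    (hPQ : P ≠ Q) (hRQ : R ≠ Q) : hAngle P Q R = Real.pi / 2 ↔
      mink (lift Q) (lift P) * mink (lift Q) (lift R) = mink (lift P) (lift R) := by
  have hsP := Real.sinh_pos_iff.mpr (hDist_pos hQ hP hPQ.symm)
  have hsR := Real.sinh_pos_iff.mpr (hDist_pos hQ hR hRQ.symm)
  rw [← sub_eq_zero (a := mink (lift Q) (lift P) * _), ← cos_hAngle hP hQ hR hPQ hRQ,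
    mul_eq_zero, or_iff_right (by positivity), ← Real.cos_pi_div_two]
  refine ⟨fun h => by rw [h], fun h => Real.injOn_cos (hAngle_mem _ _ _) ?_ h⟩
  have := Real.pi_pos
  constructor <;> linarith

theorem IsHLine.exists_normal {l : Set ℂ} (hl : IsHLine l) :
    ∃ n, mink n n = -1 ∧ l = {z | z ∈ hPlane ∧ mink (lift z) n = 0} := by
  obtain ⟨n, hn, rfl⟩ := isHLine_iff.mp hl
  have hs : 0 < √(-mink n n) := Real.sqrt_pos.mpr (by linarith)
  have hs2 : √(-mink n n) ^ 2 = -mink n n := Real.sq_sqrt (by linarith)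
  refine ⟨(√(-mink n n))⁻¹ • n, ?_, ?_⟩
  · rw [mink_smul_left, mink_smul_right, ← mul_assoc, ← sq, inv_pow, hs2]
    field_simp
    rw [div_self hn.ne]
  · simp only [mink_smul_right, mul_eq_zero, inv_eq_zero, hs.ne', false_or]

/-! ### Foot point and angle of parallelism -/

/-- The foot point is the orthogonal projection. -/
theorem isHFoot_iff {n : ℝ × ℝ × ℝ} {k : ℝ} (hk : 0 < k) {P F Q : ℂ} (hP : P ∈ hPlane)
    (hF : F ∈ hPlane) (hPn : mink (lift P) n ≠ 0) (hFn : mink (lift F) n = 0)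
    (hv : ∀ v, mink v n = 0 → mink (lift P) v = k * mink (lift F) v) :
    IsHFoot {z | z ∈ hPlane ∧ mink (lift z) n = 0} P Q ↔ Q = F := by
  have hPF : mink (lift P) (lift F) = k := by rw [hv _ hFn, mink_lift_self hF, mul_one]
  constructor
  · rintro ⟨⟨hQ, hQn⟩, h⟩
    by_contra hne
    have hPQ : P ≠ Q := by rintro rfl; exact hPn hQn
    -- Testing a second candidate `Q` against `R = F` would give `⟨Q, F⟩² = 1`.
    have h1 := (hAngle_eq_pi_div_two_iff hP hQ hF hPQ (Ne.symm hne)).mp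
      (h F ⟨hF, hFn⟩ (Ne.symm hne))
    rw [mink_comm _ (lift P), hv _ hQn, hPF, mink_comm (lift F)] at h1
    have h2 := one_lt_mink hQ hF hne
    have h3 : k * (mink (lift Q) (lift F) ^ 2 - 1) = 0 := by linear_combination h1
    rcases mul_eq_zero.mp h3 with h4 | h4
    · exact hk.ne' h4
    · nlinarith
  · rintro rfl
    refine ⟨⟨hF, hFn⟩, fun R hR hRQ => ?_⟩
    have hPQ : P ≠ Q := by rintro rfl; exact hPn hFn
    rw [hAngle_eq_pi_div_two_iff hP hF hR.1 hPQ hRQ, mink_comm _ (lift P), hPF, hv _ hR.2]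

/-- Up to scale, `⟨Z, n⟩ P - ⟨P, n⟩ Z` is the only combination of `P` and `Z` orthogonal to `n`. The
h-lines meet exactly when it is time-like, and the left-hand side is its square. -/
theorem disjoint_hLine {n : ℝ × ℝ × ℝ} {P Z : ℂ} (hP : P ∈ hPlane) (hZ : Z ∈ hPlane)
    (hPZ : P ≠ Z) (hPn : mink (lift P) n ≠ 0) :
    Disjoint (hLine P Z) {z | z ∈ hPlane ∧ mink (lift z) n = 0} ↔
      mink (lift Z) n ^ 2 - 2 * mink (lift Z) n * mink (lift P) n * mink (lift P) (lift Z) +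
        mink (lift P) n ^ 2 ≤ 0 := by
  set p := mink (lift P) n with hp
  set z := mink (lift Z) n with hz
  set C := mink (lift P) (lift Z) with hC
  rw [Set.disjoint_left]
  constructor
  · intro h
    by_contra! hc
    obtain ⟨W, hW, k, hk⟩ := exists_lift_eq_smul (v := z • lift P - p • lift Z) (by
      simp only [mink_sub_left, mink_sub_right, mink_smul_left, mink_smul_right,
        mink_lift_self hP, mink_lift_self hZ, mink_comm (lift Z) (lift P), ← hC]
      linarith)
    refine h (a := W) ?_ ⟨hW, ?_⟩
    · rw [hLine_eq_of_mem hP hZ hPZ]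
      refine ⟨hW, ?_⟩
      rw [hk, mink_smul_left, mink_sub_left, mink_smul_left, mink_smul_left, mink_cross_left,
        mink_cross_right]
      ring
    · rw [hk, mink_smul_left, mink_sub_left, mink_smul_left, mink_smul_left, ← hp, ← hz]
      ring
  · rintro h W hWl ⟨hW, hWn⟩
    obtain ⟨α, β, e⟩ := eq_smul_add_smul hP hZ hPZ hWl
    have h1 := mink_lift_self hW
    rw [e, mink_add_left, mink_smul_left, mink_smul_left, ← hp, ← hz] at hWn
    simp only [e, mink_add_left, mink_add_right, mink_smul_left, mink_smul_right,
      mink_lift_self hP, mink_lift_self hZ, mink_comm (lift Z) (lift P), ← hC] at h1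
    have h2 : p ^ 2 = β ^ 2 * (z ^ 2 - 2 * z * p * C + p ^ 2) := by
      linear_combination (-p ^ 2) * h1 + (α * p - β * z + 2 * β * p * C) * hWn
    have h3 : 0 < p ^ 2 := by positivity
    nlinarith [sq_nonneg β]

theorem isAngleOfParallelism_arccos {n : ℝ × ℝ × ℝ} (hn : mink n n = -1) {r : ℝ} (hr : 0 < r)
    {P F : ℂ} (hP : P ∈ hPlane) (hF : F ∈ hPlane) (hs : Real.sinh r = |mink (lift P) n|)
    (hFn : mink (lift F) n = 0)
    (hv : ∀ v, Real.cosh r * mink (lift F) v = mink (lift P) v + mink (lift P) n * mink n v) :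
    IsAngleOfParallelism {z | z ∈ hPlane ∧ mink (lift z) n = 0} P F
      (Real.arccos (Real.tanh r)) := by
  have hk := Real.cosh_pos r
  have hk2 := Real.cosh_sq r
  have hsp := Real.sinh_pos_iff.mpr hr
  rw [hs, sq_abs] at hk2
  set p := mink (lift P) n with hp
  have hPn : p ≠ 0 := abs_pos.mp (hs ▸ hsp)
  have hPF : mink (lift P) (lift F) = Real.cosh r := by
    have := hv (lift F)
    rw [mink_lift_self hF, mink_comm n, hFn] at this
    linarith
  have hne : F ≠ P := by
    rintro rfl
    exact hPn hFn
  have hd : hDist P F = r := (hDist_eq_iff hP hF hr.le).mpr hPF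
  have hcos : ∀ Z ∈ hPlane, Z ≠ P → Real.cosh r * (|p| * Real.sinh (hDist P Z) *
      Real.cos (hAngle F P Z)) = p * (p * mink (lift P) (lift Z) - mink (lift Z) n) := by
    intro Z hZ hZP
    have h1 := cos_hAngle hF hP hZ hne hZP
    rw [hd, hs, hPF] at h1
    have h2 := hv (lift Z)
    rw [mink_comm n] at h2
    rw [h1]
    linear_combination mink (lift P) (lift Z) * hk2 - h2
  constructor
  · have h2 : (√2 : ℝ) ^ 2 = 2 := Real.sq_sqrt zero_le_two
    -- `f` is the unit direction of `l` at `F`. The witness is `√2 P + u`, where `u = -(p²/cosh r) F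
    -- + p n + f/cosh r` is a unit vector orthogonal to `P` and `P + u = (F + f)/cosh r` is null:
    -- the line from `P` along `u` ends at an ideal point of `l`. The factor `√2` puts `Z` at a
    -- distance whose `sinh` is 1.
    set f := cross (lift F) n with hf
    have hFf : mink (lift F) f = 0 := mink_cross_left _ _
    have hnf : mink n f = 0 := mink_cross_right _ _
    have hff : mink f f = -1 := by
      rw [hf, mink_cross_cross, mink_lift_self hF, hn, hFn]; ring
    have hPf : mink (lift P) f = 0 := by
      have := hv f
      rw [hFf, hnf] at this
      linarith
    have hvP : ∀ w, mink (√2 • lift P - (p ^ 2 / Real.cosh r) • lift F + p • n +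
        (Real.cosh r)⁻¹ • f) w = √2 * mink (lift P) w - p ^ 2 / Real.cosh r * mink (lift F) w +
          p * mink n w + (Real.cosh r)⁻¹ * mink f w := by
      intro w
      simp only [mink_add_left, mink_sub_left, mink_smul_left]
    have hvP' : mink (√2 • lift P - (p ^ 2 / Real.cosh r) • lift F + p • n +
        (Real.cosh r)⁻¹ • f) (lift P) = √2 := by
      rw [hvP, mink_lift_self hP, mink_comm (lift F), hPF, mink_comm n, ← hp, mink_comm f, hPf]
      field_simp
      ring
    have hvn : mink (√2 • lift P - (p ^ 2 / Real.cosh r) • lift F + p • n +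
        (Real.cosh r)⁻¹ • f) n = √2 * p - p := by
      rw [hvP, ← hp, hFn, hn, mink_comm f, hnf]
      ring
    have hvv : mink (√2 • lift P - (p ^ 2 / Real.cosh r) • lift F + p • n +
        (Real.cosh r)⁻¹ • f) (√2 • lift P - (p ^ 2 / Real.cosh r) • lift F + p • n +
        (Real.cosh r)⁻¹ • f) = 1 := by
      have hvF := hvP (lift F)
      have hvf := hvP f
      rw [hPF, mink_lift_self hF, mink_comm n (lift F), hFn, mink_comm f (lift F), hFf] at hvF
      rw [hPf, hFf, hnf, hff] at hvf
      rw [hvP, mink_comm (lift P), mink_comm n, hvP', hvn, mink_comm (lift F), hvF, mink_comm f,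
        hvf]
      field_simp
      linear_combination Real.cosh r ^ 2 * h2 + (1 - p ^ 2) * hk2
    obtain ⟨Z, hZ, e⟩ := exists_lift_eq hvv (fst_pos (u := lift P) (by rw [hvv]; exact one_pos)
      (by rw [mink_lift_self hP]; exact one_pos) (lift_fst_pos hP) (by rw [hvP']; positivity))
    rw [← e] at hvP' hvn
    rw [mink_comm] at hvP'
    have hZP : Z ≠ P := by
      rintro rfl
      rw [mink_lift_self hP] at hvP'
      rw [← hvP'] at h2
      norm_num at h2
    refine ⟨Z, hZ, hZP, ?_, ?_⟩
    · have h3 := hcos Z hZ hZP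
      have h4 : Real.sinh (hDist P Z) = 1 := by
        rw [← sq_eq_sq₀ (Real.sinh_nonneg_iff.mpr (hDist_nonneg hP hZ)) zero_le_one,
          sinh_hDist_sq hP hZ, hvP', h2]
        norm_num
      rw [h4, hvP', hvn, mul_one] at h3
      have h5 : Real.cos (hAngle F P Z) = Real.tanh r := by
        rw [Real.tanh_eq_sinh_div_cosh, eq_div_iff hk.ne', hs]
        refine mul_left_cancel₀ (abs_ne_zero.mpr hPn) ?_
        rw [abs_mul_abs_self]
        linear_combination h3
      rw [← h5, Real.arccos_cos (hAngle_mem _ _ _).1 (hAngle_mem _ _ _).2]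
    · rw [disjoint_hLine hP hZ hZP.symm hPn, hvn, ← hp, hvP']
      refine le_of_eq ?_
      linear_combination (-p ^ 2) * h2
  · rintro α ⟨Z, hZ, hZP, rfl, hdis⟩
    rw [disjoint_hLine hP hZ hZP.symm hPn, ← hp] at hdis
    have h3 := hcos Z hZ hZP
    have hS := Real.sinh_pos_iff.mpr (hDist_pos hP hZ hZP.symm)
    have hS2 := sinh_hDist_sq hP hZ
    -- Completing the square in the disjointness condition bounds the very quantity that the law of
    -- cosines equates with the cosine of the angle.
    have h4 : |p * mink (lift P) (lift Z) - mink (lift Z) n| ≤ |p| * Real.sinh (hDist P Z) := by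
      refine abs_le_of_sq_le_sq ?_ (by positivity)
      rw [mul_pow, sq_abs, hS2]
      linarith
    have h5 : Real.cosh r * (|p| * Real.sinh (hDist P Z) * Real.cos (hAngle F P Z)) ≤
        |p| * (|p| * Real.sinh (hDist P Z)) := by
      rw [h3]
      refine (le_abs_self _).trans ?_
      rw [abs_mul]
      gcongr
    have h6 : Real.cos (hAngle F P Z) ≤ Real.tanh r := by
      rw [Real.tanh_eq_sinh_div_cosh, le_div_iff₀ hk, hs]
      refine le_of_mul_le_mul_left ?_ (mul_pos (abs_pos.mpr hPn) hS)
      linarith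
    rw [← Real.arccos_cos (hAngle_mem F P Z).1 (hAngle_mem F P Z).2]
    exact Real.arccos_le_arccos h6

theorem half_log_tanh (r : ℝ) :
    1 / 2 * Real.log ((1 + Real.tanh r) / (1 - Real.tanh r)) = r := by
  have h1 : (1 + Real.tanh r) / (1 - Real.tanh r) = Real.exp (2 * r) := by
    have hk := (Real.cosh_pos r).ne'
    have h2 := Real.cosh_sub_sinh r
    have h3 := Real.cosh_add_sinh r
    have h4 : 1 + Real.tanh r = Real.exp r / Real.cosh r := by
      rw [← h3, Real.tanh_eq_sinh_div_cosh]; field_simp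
    have h5 : 1 - Real.tanh r = Real.exp (-r) / Real.cosh r := by
      rw [← h2, Real.tanh_eq_sinh_div_cosh]; field_simp
    rw [h4, h5, div_div_div_cancel_right₀ hk, ← Real.exp_sub]
    ring_nf
  rw [h1, Real.log_exp]
  ring

theorem angleOfParallelism {l : Set ℂ} {P : ℂ} (hl : IsHLine l) (hP : P ∈ hPlane) (hPl : P ∉ l) :
    (∃! Q : ℂ, IsHFoot l P Q) ∧
      ∀ Q : ℂ, IsHFoot l P Q → ∃ φ : ℝ, IsAngleOfParallelism l P Q φ ∧
        hDist P Q = 1 / 2 * Real.log ((1 + Real.cos φ) / (1 - Real.cos φ)) := by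
  obtain ⟨n, hn, rfl⟩ := hl.exists_normal
  have hPn : mink (lift P) n ≠ 0 := fun h => hPl ⟨hP, h⟩
  -- The distance from `P` to `l`, by the tangency criterion for a unit normal.
  set r := Real.arsinh |mink (lift P) n|
  have hs : Real.sinh r = |mink (lift P) n| := Real.sinh_arsinh _
  have hr : 0 < r := Real.arsinh_pos_iff.mpr (abs_pos.mpr hPn)
  have hn1 : mink n n = -1 ^ 2 := by rw [hn]; norm_num
  obtain ⟨F, hF, e⟩ := exists_projection one_pos hn1 hP (by rw [mul_one, hs])
  rw [one_pow, div_one] at e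
  have hv : ∀ v, Real.cosh r * mink (lift F) v =
      mink (lift P) v + mink (lift P) n * mink n v :=
    fun v => by rw [← mink_smul_left, e, mink_add_left, mink_smul_left]
  have hk := Real.cosh_pos r
  have hFn : mink (lift F) n = 0 := by
    have h1 := hv n
    rw [hn] at h1
    have h2 : Real.cosh r * mink (lift F) n = 0 := by linarith
    exact (mul_eq_zero.mp h2).resolve_left hk.ne'
  have hv' : ∀ v, mink v n = 0 → mink (lift P) v = Real.cosh r * mink (lift F) v :=
    fun v h => by rw [hv, mink_comm n, h]; ring
  have hPF : hDist P F = r := (hDist_eq_iff hP hF hr.le).mpr (by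
    rw [hv' _ hFn, mink_lift_self hF, mul_one])
  simp only [isHFoot_iff hk hP hF hPn hFn hv']
  refine ⟨⟨F, rfl, fun _ h => h⟩, ?_⟩
  rintro Q rfl
  refine ⟨_, isAngleOfParallelism_arccos hn hr hP hF hs hFn hv, ?_⟩
  rw [hPF, Real.cos_arccos (Real.neg_one_lt_tanh r).le (Real.tanh_lt_one r).le, half_log_tanh]

end PoincareDisk

theorem mainTheorem12 :
    -- every h-triangle has exactly one incircle, and the inradius is less than `½ ln 3`
    (∀ X Y Z : ℂ, IsHTriangle X Y Z →
      (∃! p : ℂ × ℝ, IsHIncircle X Y Z p.1 p.2) ∧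
      ∀ (I : ℂ) (r : ℝ), IsHIncircle X Y Z I r → r < 1 / 2 * Real.log 3) ∧
    -- every ideal triangle has exactly one incircle, of radius `½ ln 3`, and the inradius of an
    -- h-triangle tends to `½ ln 3` as its vertices tend to those of the ideal triangle
    (∀ A ∈ absolute, ∀ B ∈ absolute, ∀ C ∈ absolute, A ≠ B → B ≠ C → C ≠ A →
      (∃! p : ℂ × ℝ, IsIdealIncircle A B C p.1 p.2) ∧
      (∀ (I : ℂ) (r : ℝ), IsIdealIncircle A B C I r → r = 1 / 2 * Real.log 3) ∧
      ∀ ε : ℝ, 0 < ε → ∀ᶠ T in 𝓝[hPlane ×ˢ hPlane ×ˢ hPlane] (A, B, C),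
        IsHTriangle T.1 T.2.1 T.2.2 ∧
        ∀ (I : ℂ) (r : ℝ), IsHIncircle T.1 T.2.1 T.2.2 I r → 1 / 2 * Real.log 3 - ε < r) ∧
    -- the angle of parallelism formula
    (∀ (l : Set ℂ) (P : ℂ), IsHLine l → P ∈ hPlane → P ∉ l →
      (∃! Q : ℂ, IsHFoot l P Q) ∧
      ∀ Q : ℂ, IsHFoot l P Q → ∃ φ : ℝ, IsAngleOfParallelism l P Q φ ∧
        hDist P Q = 1 / 2 * Real.log ((1 + Real.cos φ) / (1 - Real.cos φ))) := by
  exact ⟨fun X Y Z h => ⟨existsUnique_isHIncircle h, fun I r => inradius_lt h⟩,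
    fun A hA B hB C hC hAB hBC hCA => ⟨existsUnique_isIdealIncircle hA hB hC hAB hBC hCA,
      fun I r => idealIncircle_radius hA hB hC hAB hBC hCA,
      fun ε => eventually_isHTriangle hA hB hC hAB hBC hCA⟩,
    fun l P => angleOfParallelism⟩
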